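/- **Theorem A3.** Let $\mathcal N$ be a von Neumann algebra on a complex Hilbert space $H$, let $\mathfrak Z$ be a unital von Neumann subalgebra of the centre of $\mathcal N$, and identify $\mathfrak Z$ with $L^\infty(X,\nu)$ for a measure space $(X,\nu)$ by a $*$-isomorphism. Let $\hat{\mathfrak Z}_+\supseteq\mathfrak Z_+$ be the set of measurable functions $X\to[0,\infty]$ modulo $\nu$-almost everywhere equality (with $0\cdot\infty=0$). Let $\phi:\mathcal N_+\to\hat{\mathfrak Z}_+$ be a faithful, normal, semifinite $\mathfrak Z$-trace, that is: * $\phi(A+B)=\phi(A)+\phi(B)$, $\phi(CA)=C\,\phi(A)$ and $\phi(UAU^*)=\phi(A)$ for all $A,B\in\mathcal N_+$, $C\in\mathfrak Z_+$ and all unitaries $U\in\mathcal N$; * (faithful) $\phi(A)=0$ implies $A=0$; * (normal) $\phi(\sup_\alpha A_\alpha)=\sup_\alpha\phi(A_\alpha)$ for every bounded increasing net $(A_\alpha)$ in $\mathcal N_+$; * (semifinite) for every nonzero $A\in\mathcal N_+$ there is a nonzero $B\in\mathcal N_+$ with $B\le A$ and $\phi(B)\in\mathfrak Z_+$. Write $\phi$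 also for its unique linear extension, with values in $\mathfrak Z$, to the linear span $\mathcal I$ of $\{A\in\mathcal N_+ : \phi(A)\in\mathfrak Z_+\}$. A projection $E\in\mathcal N$ is $\phi$-finite if $\phi(E)\in\mathfrak Z_+$. For $T\in\mathcal N$ let $N_T\in\mathcal N$ be the orthogonal projection onto $\ker T$; $T$ is $\phi$-Fredholm if $N_T$ is $\phi$-finite and there is a $\phi$-finite projection $E\in\mathcal N$ with $\operatorname{range}(1-E)\subseteq\operatorname{range}(T)$, and then $\phi\text{-Index}(T)=\phi(N_T)-\phi(N_{T^*})\in\mathfrak Z$. An operator $R\in\mathcal N$ is $n$-summable if $\phi(|R|^n)\in\mathfrak Z_+$, where $|R|=(R^*R)^{1/2}$. Let $n\ge 1$ be an integer and let $S,T\in\mathcal N$ be such that $R_1=1-ST$ and $R_2=1-TS$ are both $n$-summable. Then $T$ is $\phi$-Fredholm, $N_{T^*}$ is $\phi$-finite (so that the index is defined), $R_1^n$ and $R_2^n$ lie in $\mathcal I$, and $$\phi\text{-Index}(T)=\phi(R_1^n)-\phi(R_2^n).$$ -/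

import Mathlib

open MeasureTheory
open scoped ENNReal

namespace CentreTrace

noncomputable section

section Cone

variable {H : Type*} [NormedAddCommGroup H] [InnerProductSpace ℂ H] [CompleteSpace H]

/-- The cone `N₊` of positive operators of a von Neumann algebra `N` acting on `H`. -/
def posCone (N : VonNeumannAlgebra H) : AddSubmonoid (H →L[ℂ] H) where
  carrier := {x | x ∈ N ∧ 0 ≤ x}
  zero_mem' := ⟨zero_mem N, le_rfl⟩
  add_mem' := fun ha hb => ⟨add_mem ha.1 hb.1, add_nonneg ha.2 hb.2⟩

/-- The conjugate `u s u*` of a positive operator `s` of `N` by an element `u` of `N`. -/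
def conjBy {N : VonNeumannAlgebra H} (u : H →L[ℂ] H) (hu : u ∈ N) (s : posCone N) : posCone N :=
  ⟨u * s * star u, mul_mem (mul_mem hu s.2.1) (star_mem hu), star_right_conjugate_nonneg s.2.2 u⟩

theorem mem_of_commute {N : VonNeumannAlgebra H} {x : H →L[ℂ] H}
    (h : ∀ y ∈ N.commutant, Commute x y) : x ∈ N := by
  rw [← N.commutant_commutant, VonNeumannAlgebra.mem_commutant_iff]
  exact fun y hy => (h y hy).symm.eq

theorem commute_of_mem {N : VonNeumannAlgebra H} {x y : H →L[ℂ] H} (hx : x ∈ N)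
    (hy : y ∈ N.commutant) : Commute x y :=
  VonNeumannAlgebra.mem_commutant_iff.1 hy x hx

theorem sqrt_mem {N : VonNeumannAlgebra H} {x : H →L[ℂ] H} (hx : x ∈ N) : CFC.sqrt x ∈ N :=
  mem_of_commute fun y hy => by
    rw [CFC.sqrt]; exact (commute_of_mem hx hy).cfcₙ_nnreal _

theorem smul_mem (N : VonNeumannAlgebra H) (c : ℂ) {x : H →L[ℂ] H} (hx : x ∈ N) : c • x ∈ N :=
  N.toStarSubalgebra.smul_mem hx c

/-- The positive operator `|x| ^ n` lies in `N₊` for every `x` in `N`. -/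
theorem abs_pow_mem {N : VonNeumannAlgebra H} {x : H →L[ℂ] H} (hx : x ∈ N) (n : ℕ) :
    CFC.abs x ^ n ∈ posCone N :=
  ⟨pow_mem (sqrt_mem (mul_mem (star_mem hx) hx)) n, CStarAlgebra.pow_nonneg (CFC.abs_nonneg x) n⟩

/-- The orthogonal projection `N_T` of `H` onto the kernel of `T`. -/
def kerProj (T : H →L[ℂ] H) : H →L[ℂ] H :=
  haveI : CompleteSpace (T.ker : Submodule ℂ H) := T.isClosed_ker.completeSpace_coe
  (T.ker : Submodule ℂ H).starProjection

theorem kerProj_mem {N : VonNeumannAlgebra H} {T : H →L[ℂ] H} (hT : T ∈ N) :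
    kerProj T ∈ posCone N := by
  have : CompleteSpace (T.ker : Submodule ℂ H) := T.isClosed_ker.completeSpace_coe
  have hp : IsStarProjection (kerProj T) := isStarProjection_starProjection
  refine ⟨(VonNeumannAlgebra.IsStarProjection.mem_iff hp N).2 fun y hy => ?_, hp.nonneg⟩
  have hr : (kerProj T).range = T.ker := Submodule.range_starProjection _
  rw [hr]
  intro v hv
  have hv' : T v = 0 := hv
  have h := congrArg (fun A : H →L[ℂ] H => A v) (commute_of_mem hT hy).eq
  change T (y v) = 0
  simpa [hv'] using h

end Cone

section Values

variable {H : Type*} [NormedAddCommGroup H] [InnerProductSpace ℂ H] [CompleteSpace H]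
variable {X : Type*} [MeasurableSpace X]

/-- An isomorphism of `*`-algebras of the von Neumann algebra `Z` onto `L^∞(X, ν)`, the
essentially bounded elements among the `ν`-classes of measurable functions `X → ℂ`. -/
structure LInftyIso (Z : VonNeumannAlgebra H) (ν : Measure X) where
  /-- the function class attached to an element of `Z` -/
  toFun : Z.toStarSubalgebra → (X →ₘ[ν] ℂ)
  map_add : ∀ a b, toFun (a + b) = toFun a + toFun b
  map_mul : ∀ a b, toFun (a * b) = toFun a * toFun b
  map_smul : ∀ (c : ℂ) a, toFun (c • a) = c • toFun a
  map_star : ∀ a, toFun (star a) = star (toFun a)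
  injective : Function.Injective toFun
  range_eq : Set.range toFun = (Lp ℂ ∞ ν : Set (X →ₘ[ν] ℂ))

variable {Z : VonNeumannAlgebra H} {ν : Measure X}

/-- The embedding of `Z₊` into the set of `ν`-classes of measurable functions `X → [0, ∞]`. -/
def LInftyIso.pos (e : LInftyIso Z ν) (z : posCone Z) : X →ₘ[ν] ℝ≥0∞ :=
  AEEqFun.compMeasurable (fun c : ℂ => ENNReal.ofReal c.re)
    (ENNReal.measurable_ofReal.comp Complex.measurable_re) (e.toFun ⟨z, z.2.1⟩)

/-- The product of two classes of `[0, ∞]`-valued functions, with the convention `0 * ∞ = 0`. -/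
def valMul (f g : X →ₘ[ν] ℝ≥0∞) : X →ₘ[ν] ℝ≥0∞ :=
  AEEqFun.comp₂Measurable (fun a b : ℝ≥0∞ => a * b) measurable_mul f g

/-- A `Z`-trace on `N₊`: a map from `N₊` to the `ν`-classes of measurable functions
`X → [0, ∞]`, where `Z` is identified with `L^∞(X, ν)` by `e`. In `map_mul`, `p` is the product
`t * s`, which is positive when `Z` is central in `N`. -/
structure ZTrace (N Z : VonNeumannAlgebra H) (e : LInftyIso Z ν) where
  /-- the map on the positive cone -/
  toFun : posCone N → (X →ₘ[ν] ℝ≥0∞)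
  map_add : ∀ s t, toFun (s + t) = toFun s + toFun t
  map_mul : ∀ (t : posCone Z) (s p : posCone N), (p : H →L[ℂ] H) = t * s →
    toFun p = valMul (e.pos t) (toFun s)
  map_conj : ∀ (u : H →L[ℂ] H) (hu : u ∈ N), u ∈ unitary (H →L[ℂ] H) →
    ∀ s, toFun (conjBy u hu s) = toFun s

namespace ZTrace

variable {N : VonNeumannAlgebra H} {e : LInftyIso Z ν} (φ : ZTrace N Z e)

/-- `x` is a positive operator of `N` with `φ(x)` in `Z₊`. -/
def IsFinite (x : H →L[ℂ] H) : Prop :=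
  ∃ (hx : x ∈ posCone N) (z : posCone Z), φ.toFun ⟨x, hx⟩ = e.pos z

def Faithful : Prop := ∀ s, φ.toFun s = 0 → s = 0

def Semifinite : Prop :=
  ∀ s : posCone N, s ≠ 0 → ∃ t : posCone N, t ≠ 0 ∧ t ≤ s ∧ φ.IsFinite t

/-- `φ` preserves the suprema of the upward directed sets that have one in `N₊`
(equivalently, of the bounded increasing nets). -/
def Normal : Prop :=
  ∀ (D : Set (posCone N)) (s : posCone N), D.Nonempty → DirectedOn (· ≤ ·) D → IsLUB D s →
    IsLUB (φ.toFun '' D) (φ.toFun s)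

/-- The ideal of definition of `φ`: the linear span of the positive operators `x` of `N` with
`φ(x)` in `Z₊`. -/
def ideal : Submodule ℂ (H →L[ℂ] H) := Submodule.span ℂ {x | φ.IsFinite x}

/-- The pairs `(x, φ(x))` with `x` in `N₊` and `φ(x)` in `Z₊`. -/
def posGraph : Set ((H →L[ℂ] H) × Z.toStarSubalgebra) :=
  {q | ∃ (x : posCone N) (z : posCone Z), φ.toFun x = e.pos z ∧
    q = ((x : H →L[ℂ] H), ⟨z, z.2.1⟩)}

/-- The linear span of `posGraph`. -/
def traceGraph : Submodule ℂ ((H →L[ℂ] H) × Z.toStarSubalgebra) := Submodule.span ℂ φ.posGraph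

/-- The linear extension of `φ` to its ideal of definition, with values in `Z`, as the partially
defined linear map whose graph is `traceGraph` (see `ext_graph`, `ext_domain`, `tr_of_pos`). -/
def ext : (H →L[ℂ] H) →ₗ.[ℂ] Z.toStarSubalgebra := φ.traceGraph.toLinearPMap

end ZTrace

/-- A positive element of `Z` corresponds to a class of nonnegative real functions. -/
theorem LInftyIso.ae_nonneg (e : LInftyIso Z ν) (z : posCone Z) :
    ∀ᵐ a ∂ν, 0 ≤ (e.toFun ⟨z, z.2.1⟩ a).re ∧ (e.toFun ⟨z, z.2.1⟩ a).im = 0 := by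
  let w : Z.toStarSubalgebra := ⟨CFC.sqrt (z : H →L[ℂ] H), sqrt_mem z.2.1⟩
  have hw : (⟨z, z.2.1⟩ : Z.toStarSubalgebra) = star w * w := by
    apply Subtype.ext
    change (z : H →L[ℂ] H) = star (CFC.sqrt (z : H →L[ℂ] H)) * CFC.sqrt (z : H →L[ℂ] H)
    rw [(IsSelfAdjoint.of_nonneg (CFC.sqrt_nonneg _)).star_eq]
    exact (CFC.sqrt_mul_sqrt_self (z : H →L[ℂ] H) z.2.2).symm
  rw [hw, e.map_mul, e.map_star]
  filter_upwards [AEEqFun.coeFn_mul (star (e.toFun w)) (e.toFun w),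
    AEEqFun.coeFn_star (e.toFun w)] with a h1 h2
  rw [h1]
  simp only [Pi.mul_apply, h2, Pi.star_apply]
  constructor
  · simp [Complex.mul_re]; nlinarith [sq_nonneg (e.toFun w a).re, sq_nonneg (e.toFun w a).im]
  · simp [Complex.mul_im]; ring

theorem LInftyIso.coeFn_pos (e : LInftyIso Z ν) (z : posCone Z) :
    e.pos z =ᵐ[ν] fun a => ENNReal.ofReal (e.toFun ⟨z, z.2.1⟩ a).re :=
  AEEqFun.coeFn_compMeasurable _ _ _

theorem LInftyIso.pos_injective (e : LInftyIso Z ν) : Function.Injective e.pos := by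
  intro z z' h
  have : e.toFun ⟨z, z.2.1⟩ = e.toFun ⟨z', z'.2.1⟩ := by
    apply AEEqFun.ext
    have h1 := e.coeFn_pos z
    rw [h] at h1
    filter_upwards [h1, e.coeFn_pos z', e.ae_nonneg z, e.ae_nonneg z'] with a h1 h2 h3 h4
    rw [h1] at h2
    apply Complex.ext
    · exact (ENNReal.ofReal_eq_ofReal_iff h3.1 h4.1).1 h2
    · rw [h3.2, h4.2]
  exact Subtype.ext (congrArg (fun x : Z.toStarSubalgebra => (x : H →L[ℂ] H)) (e.injective this))

theorem LInftyIso.pos_add (e : LInftyIso Z ν) (z z' : posCone Z) :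
    e.pos (z + z') = e.pos z + e.pos z' := by
  apply AEEqFun.ext
  have h0 : e.toFun ⟨(z + z' : posCone Z), (z + z').2.1⟩ =
    e.toFun ⟨z, z.2.1⟩ + e.toFun ⟨z', z'.2.1⟩ := by
      rw [← e.map_add]; rfl
  have h1 := e.coeFn_pos (z + z')
  rw [h0] at h1
  filter_upwards [h1, e.coeFn_pos z, e.coeFn_pos z', e.ae_nonneg z, e.ae_nonneg z',
    AEEqFun.coeFn_add (e.toFun ⟨z, z.2.1⟩) (e.toFun ⟨z', z'.2.1⟩),
    AEEqFun.coeFn_add (e.pos z) (e.pos z')] with a h1 h2 h3 h4 h5 h6 h7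
  rw [h1, h7, h6, Pi.add_apply, Pi.add_apply, h2, h3, Complex.add_re,
    ENNReal.ofReal_add h4.1 h5.1]

namespace ZTrace

variable {N : VonNeumannAlgebra H} {e : LInftyIso Z ν} (φ : ZTrace N Z e)

theorem zero_mem_posGraph : (0 : (H →L[ℂ] H) × Z.toStarSubalgebra) ∈ φ.posGraph := by
  refine ⟨0, 0, ?_, rfl⟩
  rw [φ.map_mul 0 0 0 (by simp)]
  apply AEEqFun.ext
  have h0 : e.toFun ⟨(0 : posCone Z), (0 : posCone Z).2.1⟩ = 0 := by
    have := e.map_add 0 0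
    rw [add_zero] at this
    exact left_eq_add.1 this
  have h1 := e.coeFn_pos 0
  rw [h0] at h1
  filter_upwards [h1, AEEqFun.coeFn_comp₂Measurable (fun a b : ℝ≥0∞ => a * b) measurable_mul
    (e.pos 0) (φ.toFun 0), AEEqFun.coeFn_zero (μ := ν) (β := ℂ)] with a h1 h2 h3
  rw [h3] at h1
  rw [valMul, h2, h1]
  simp

theorem add_mem_posGraph {p q : (H →L[ℂ] H) × Z.toStarSubalgebra} (hp : p ∈ φ.posGraph)
    (hq : q ∈ φ.posGraph) : p + q ∈ φ.posGraph := by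
  obtain ⟨x, z, h, rfl⟩ := hp
  obtain ⟨y, w, k, rfl⟩ := hq
  exact ⟨x + y, z + w, by rw [φ.map_add, h, k, e.pos_add], rfl⟩

theorem smul_nonneg_posCone {N : VonNeumannAlgebra H} {r : ℝ} (hr : 0 ≤ r) {x : H →L[ℂ] H}
    (hx : x ∈ posCone N) : (r : ℂ) • x ∈ posCone N :=
  ⟨smul_mem N _ hx.1, by rw [Complex.coe_smul]; exact smul_nonneg hr hx.2⟩

theorem smul_mem_posGraph {p : (H →L[ℂ] H) × Z.toStarSubalgebra} {r : ℝ} (hr : 0 ≤ r)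
    (hp : p ∈ φ.posGraph) : (r : ℂ) • p ∈ φ.posGraph := by
  obtain ⟨x, z, h, rfl⟩ := hp
  have h1 : (1 : H →L[ℂ] H) ∈ posCone Z := ⟨one_mem Z, zero_le_one⟩
  refine ⟨⟨_, smul_nonneg_posCone hr x.2⟩, ⟨_, smul_nonneg_posCone hr z.2⟩, ?_, rfl⟩
  rw [φ.map_mul ⟨_, smul_nonneg_posCone hr h1⟩ x _ (by simp), h]
  apply AEEqFun.ext
  have e1 : e.toFun ⟨(r : ℂ) • (z : H →L[ℂ] H), (smul_nonneg_posCone hr z.2).1⟩ =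
      e.toFun ⟨(r : ℂ) • (1 : H →L[ℂ] H), (smul_nonneg_posCone hr h1).1⟩ *
        e.toFun ⟨z, z.2.1⟩ := by
    rw [← e.map_mul]
    refine congrArg e.toFun (Subtype.ext ?_)
    change (r : ℂ) • (z : H →L[ℂ] H) = (r : ℂ) • (1 : H →L[ℂ] H) * (z : H →L[ℂ] H)
    simp
  have e2 := e.coeFn_pos ⟨_, smul_nonneg_posCone hr z.2⟩
  rw [e1] at e2
  filter_upwards [e2, e.coeFn_pos ⟨_, smul_nonneg_posCone hr h1⟩, e.coeFn_pos z,
    e.ae_nonneg z, e.ae_nonneg ⟨_, smul_nonneg_posCone hr h1⟩,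
    AEEqFun.coeFn_mul (e.toFun ⟨(r : ℂ) • (1 : H →L[ℂ] H), (smul_nonneg_posCone hr h1).1⟩)
      (e.toFun ⟨z, z.2.1⟩),
    AEEqFun.coeFn_comp₂Measurable (fun a b : ℝ≥0∞ => a * b) measurable_mul
      (e.pos ⟨_, smul_nonneg_posCone hr h1⟩) (e.pos z)] with a k1 k2 k3 k4 k5 k6 k7
  rw [valMul, k7, k1, k2, k3, k6, Pi.mul_apply, Complex.mul_re, k4.2, mul_zero, sub_zero,
    ENNReal.ofReal_mul k5.1]

/-- Every pair in `traceGraph` is a combination `p₁ - p₂ + i (p₃ - p₄)` of pairs over `N₊`. -/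
theorem exists_of_mem_traceGraph {q : (H →L[ℂ] H) × Z.toStarSubalgebra}
    (hq : q ∈ φ.traceGraph) : ∃ p₁ ∈ φ.posGraph, ∃ p₂ ∈ φ.posGraph, ∃ p₃ ∈ φ.posGraph,
      ∃ p₄ ∈ φ.posGraph, q = p₁ - p₂ + Complex.I • (p₃ - p₄) := by
  have hz := φ.zero_mem_posGraph
  refine Submodule.span_induction (p := fun q _ => ∃ p₁ ∈ φ.posGraph, ∃ p₂ ∈ φ.posGraph,
    ∃ p₃ ∈ φ.posGraph, ∃ p₄ ∈ φ.posGraph, q = p₁ - p₂ + Complex.I • (p₃ - p₄)) ?_ ?_ ?_ ?_ hq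
  · intro p hp
    exact ⟨p, hp, 0, hz, 0, hz, 0, hz, by simp⟩
  · exact ⟨0, hz, 0, hz, 0, hz, 0, hz, by simp⟩
  · rintro x y - - ⟨a, ha, b, hb, c, hc, d, hd, rfl⟩ ⟨a', ha', b', hb', c', hc', d', hd', rfl⟩
    refine ⟨_, φ.add_mem_posGraph ha ha', _, φ.add_mem_posGraph hb hb', _,
      φ.add_mem_posGraph hc hc', _, φ.add_mem_posGraph hd hd', ?_⟩
    module
  · rintro k x - ⟨a, ha, b, hb, c, hc, d, hd, rfl⟩
    have hm : ∀ r : ℝ, 0 ≤ max r 0 := fun r => le_max_right r 0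
    have hsplit : ∀ r : ℝ, ((max r 0 : ℝ) : ℂ) - ((max (-r) 0 : ℝ) : ℂ) = (r : ℂ) := by
      intro r
      rw [← Complex.ofReal_sub]
      congr 1
      rcases le_total 0 r with h | h
      · rw [max_eq_left h, max_eq_right (by linarith)]; ring
      · rw [max_eq_right h, max_eq_left (by linarith)]; ring
    have hk : k = (((max k.re 0 : ℝ) : ℂ) - ((max (-k.re) 0 : ℝ) : ℂ)) +
        (((max k.im 0 : ℝ) : ℂ) - ((max (-k.im) 0 : ℝ) : ℂ)) * Complex.I := by
      rw [hsplit, hsplit]; exact (Complex.re_add_im k).symm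
    set A : ℂ := ((max k.re 0 : ℝ) : ℂ)
    set B : ℂ := ((max (-k.re) 0 : ℝ) : ℂ)
    set C : ℂ := ((max k.im 0 : ℝ) : ℂ)
    set D : ℂ := ((max (-k.im) 0 : ℝ) : ℂ)
    have hA : ∀ {p}, p ∈ φ.posGraph → A • p ∈ φ.posGraph := φ.smul_mem_posGraph (hm _)
    have hB : ∀ {p}, p ∈ φ.posGraph → B • p ∈ φ.posGraph := φ.smul_mem_posGraph (hm _)
    have hC : ∀ {p}, p ∈ φ.posGraph → C • p ∈ φ.posGraph := φ.smul_mem_posGraph (hm _)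
    have hD : ∀ {p}, p ∈ φ.posGraph → D • p ∈ φ.posGraph := φ.smul_mem_posGraph (hm _)
    have add4 : ∀ {p q r s}, p ∈ φ.posGraph → q ∈ φ.posGraph → r ∈ φ.posGraph →
        s ∈ φ.posGraph → p + q + r + s ∈ φ.posGraph := fun h1 h2 h3 h4 =>
      φ.add_mem_posGraph (φ.add_mem_posGraph (φ.add_mem_posGraph h1 h2) h3) h4
    refine ⟨_, add4 (hA ha) (hB hb) (hC hd) (hD hc), _, add4 (hA hb) (hB ha) (hC hc) (hD hd),
      _, add4 (hA hc) (hB hd) (hC ha) (hD hb), _, add4 (hA hd) (hB hc) (hC hb) (hD ha), ?_⟩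
    rw [hk]
    have hI : Complex.I * Complex.I = -1 := Complex.I_mul_I
    match_scalars <;>
      first
      | linear_combination (C - D) * hI
      | linear_combination (D - C) * hI
      | ring

/-- `traceGraph` is the graph of a function. -/
theorem traceGraph_snd_eq_zero : ∀ q ∈ φ.traceGraph, q.1 = 0 → q.2 = 0 := by
  intro q hq h0
  obtain ⟨_, ⟨x₁, z₁, h₁, rfl⟩, _, ⟨x₂, z₂, h₂, rfl⟩, _, ⟨x₃, z₃, h₃, rfl⟩, _, ⟨x₄, z₄, h₄, rfl⟩,
    rfl⟩ := φ.exists_of_mem_traceGraph hq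
  have hsa : ∀ x : posCone N, star (x : H →L[ℂ] H) = x := fun x =>
    (IsSelfAdjoint.of_nonneg x.2.2).star_eq
  have hc : (x₁ : H →L[ℂ] H) - x₂ + Complex.I • ((x₃ : H →L[ℂ] H) - x₄) = 0 := h0
  have hs := congrArg star hc
  simp only [star_add, star_sub, star_smul, hsa, star_zero, RCLike.star_def, Complex.conj_I] at hs
  have e12 : x₁ = x₂ := by
    apply Subtype.ext
    have h2 : (2 : ℂ) • ((x₁ : H →L[ℂ] H) - x₂) = 0 := by
      rw [← add_zero (0 : H →L[ℂ] H)]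
      nth_rewrite 1 [← hc]
      rw [← hs]
      module
    exact sub_eq_zero.1 ((smul_eq_zero.1 h2).resolve_left two_ne_zero)
  have e34 : x₃ = x₄ := by
    apply Subtype.ext
    rw [e12, sub_self, zero_add] at hc
    exact sub_eq_zero.1 ((smul_eq_zero.1 hc).resolve_left Complex.I_ne_zero)
  subst e12 e34
  have z12 : z₁ = z₂ := e.pos_injective (h₁.symm.trans h₂)
  have z34 : z₃ = z₄ := e.pos_injective (h₃.symm.trans h₄)
  subst z12 z34
  simp

theorem ext_graph : φ.ext.graph = φ.traceGraph :=
  Submodule.toLinearPMap_graph_eq _ φ.traceGraph_snd_eq_zero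

/-- The extension is defined exactly on the ideal of definition. -/
theorem ext_domain : φ.ext.domain = φ.ideal := by
  rw [ext, Submodule.toLinearPMap_domain, traceGraph, Submodule.map_span, ideal]
  congr 1
  ext x
  constructor
  · rintro ⟨_, ⟨y, z, h, rfl⟩, rfl⟩
    exact ⟨y.2, z, h⟩
  · rintro ⟨hx, z, h⟩
    exact ⟨_, ⟨⟨x, hx⟩, z, h, rfl⟩, rfl⟩

open Classical in
/-- The value in `Z` of the linearly extended trace, meaningful on the ideal of definition (it is
set to `0` elsewhere). -/
def tr (x : H →L[ℂ] H) : Z.toStarSubalgebra :=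
  if hx : x ∈ φ.ideal then φ.ext ⟨x, φ.ext_domain.symm ▸ hx⟩ else 0

theorem mk_tr_mem_traceGraph {x : H →L[ℂ] H} (hx : x ∈ φ.ideal) : (x, φ.tr x) ∈ φ.traceGraph := by
  rw [← φ.ext_graph, tr, dif_pos hx]
  exact φ.ext.mem_graph ⟨x, φ.ext_domain.symm ▸ hx⟩

/-- The extension restricts to `φ` on the positive operators of finite trace. -/
theorem tr_of_pos {x : posCone N} {z : posCone Z} (h : φ.toFun x = e.pos z) :
    φ.tr x = ⟨z, z.2.1⟩ := by
  have hx : (x : H →L[ℂ] H) ∈ φ.ideal := Submodule.subset_span ⟨x.2, z, h⟩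
  have h1 := φ.mk_tr_mem_traceGraph hx
  have h2 : ((x : H →L[ℂ] H), (⟨z, z.2.1⟩ : Z.toStarSubalgebra)) ∈ φ.traceGraph :=
    Submodule.subset_span ⟨x, z, h, rfl⟩
  have h3 := φ.traceGraph_snd_eq_zero _ (sub_mem h1 h2) (sub_self _)
  exact sub_eq_zero.1 h3

/-- The operator `T` of `N` is `φ`-Fredholm: the projection onto its kernel is `φ`-finite, and
there is a `φ`-finite projection `E` of `N` with `range (1 - E) ⊆ range T`. -/
def IsFredholm (T : H →L[ℂ] H) : Prop :=
  φ.IsFinite (kerProj T) ∧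
    ∃ E : H →L[ℂ] H, IsStarProjection E ∧ φ.IsFinite E ∧ (1 - E).range ≤ T.range

/-- The `φ`-index `φ(N_T) - φ(N_{T*})`, meaningful when both projections are `φ`-finite. -/
def index (T : H →L[ℂ] H) : Z.toStarSubalgebra := φ.tr (kerProj T) - φ.tr (kerProj (star T))

/-- `R` is `n`-summable: `φ(|R| ^ n)` lies in `Z₊`. -/
def IsSummable (n : ℕ) (R : H →L[ℂ] H) : Prop := φ.IsFinite (CFC.abs R ^ n)

end ZTrace
end Values

end

end CentreTrace

/-! Two facts carry the proof. First, the index formula holds when the remainders `1 - S * T` and `1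
- T * S` themselves lie in the ideal of definition (`index_eq_of_mem_ideal`). Second, `R ^ n` lies
in that ideal as soon as `R` is `n`-summable (`pow_mem_ideal`). They are joined by replacing `S`
with `P = S (1 + R₂ + ... + R₂ ^ (n - 1))`, whose remainders are `R₁ ^ n` and `R₂ ^ n`.

For the first fact, `φ(1 - S T) - φ(1 - T S)` does not change when `S` is altered by an element `D`
of the ideal, because `φ(T D) = φ(D T)`. So it may be computed for `S' = max(T* T, r)⁻¹ T*`. With
the polar decomposition `T = u |T|` and `K = (1 - T* T / r)₊` one has `1 - S' T = K` and `1 - T S' =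
N_{T*} + u K u*`, while `φ(u K u*) = φ(K u* u) = φ(K) - φ(N_T)`. The operator `K` is finite for
small `r` (`isFinite_nearKer`).

The second fact is a qualitative Hölder inequality. Let `e` be the spectral projection of `|R|`
above `t`. A vector killed by `e R ^ i` for all `i < n` satisfies `‖R ^ n v‖ ≤ t ^ n ‖v‖`, so it
cannot be a nonzero vector of the spectral subspace of `|R ^ n|` above `2 t ^ n`. Removing right
supports one operator at a time gives that subspace trace at most `n φ(e)`. Summing over `t = 2 ^
(-k)` bounds the truncations of `|R ^ n|` by a fixed multiple of `φ(|R| ^ n)`, and normality passes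
to `|R ^ n|`. -/

namespace CentreTrace

noncomputable section

/-! ### Quadratic forms of operators. -/

section Inner

variable {H : Type*} [NormedAddCommGroup H] [InnerProductSpace ℂ H]

theorem re_inner_le_of_le {A B : H →L[ℂ] H} (h : A ≤ B) (v : H) :
    RCLike.re (inner ℂ (A v) v) ≤ RCLike.re (inner ℂ (B v) v) := by
  have := ((ContinuousLinearMap.le_def A B).1 h).re_inner_nonneg_left v
  rw [sub_apply, inner_sub_left, map_sub] at this
  linarith

theorem re_inner_smul_self (r : ℝ) (v : H) : RCLike.re (inner ℂ (r • v) v) = r * ‖v‖ ^ 2 := by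
  rw [← Complex.coe_smul, inner_smul_left, Complex.conj_ofReal, inner_self_eq_norm_sq_to_K]
  change ((r : ℂ) * (‖v‖ : ℂ) ^ 2).re = _
  rw [Complex.re_ofReal_mul, ← Complex.ofReal_pow, Complex.ofReal_re]

theorem mul_apply_eq_zero {A B : H →L[ℂ] H} {v : H} (h : B v = 0) : (A * B) v = 0 := by
  change A (B v) = 0
  rw [h, map_zero]

end Inner

/-! ### Kernel projections and supports. -/

section Supports

variable {H : Type*} [NormedAddCommGroup H] [InnerProductSpace ℂ H] [CompleteSpace H]

theorem isStarProjection_kerProj (T : H →L[ℂ] H) : IsStarProjection (kerProj T) := by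
  have : CompleteSpace (T.ker : Submodule ℂ H) := T.isClosed_ker.completeSpace_coe
  exact isStarProjection_starProjection

theorem kerProj_apply_eq_self_iff {T : H →L[ℂ] H} {v : H} : kerProj T v = v ↔ T v = 0 := by
  have : CompleteSpace (T.ker : Submodule ℂ H) := T.isClosed_ker.completeSpace_coe
  exact Submodule.starProjection_eq_self_iff

theorem range_kerProj (T : H →L[ℂ] H) : (kerProj T).range = T.ker := by
  have : CompleteSpace (T.ker : Submodule ℂ H) := T.isClosed_ker.completeSpace_coe
  exact Submodule.range_starProjection _

theorem mul_kerProj (T : H →L[ℂ] H) : T * kerProj T = 0 := by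
  ext v
  have h : kerProj T (kerProj T v) = kerProj T v :=
    congrArg (fun A : H →L[ℂ] H => A v) (isStarProjection_kerProj T).isIdempotentElem.eq
  simpa using kerProj_apply_eq_self_iff.1 h

/-- If `T y = 0`, the projection onto `ker T` fixes `y`. -/
theorem kerProj_mul {T y : H →L[ℂ] H} (h : T * y = 0) : kerProj T * y = y := by
  ext v
  exact kerProj_apply_eq_self_iff.2 (congrArg (fun A : H →L[ℂ] H => A v) h)

/-- The projection onto the orthogonal complement of the kernel of `T`. -/
def supp (T : H →L[ℂ] H) : H →L[ℂ] H := 1 - kerProj T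

theorem isStarProjection_supp (T : H →L[ℂ] H) : IsStarProjection (supp T) :=
  (isStarProjection_kerProj T).one_sub

theorem supp_mul_supp (T : H →L[ℂ] H) : supp T * supp T = supp T :=
  (isStarProjection_supp T).isIdempotentElem.eq

theorem star_supp (T : H →L[ℂ] H) : star (supp T) = supp T :=
  (isStarProjection_supp T).isSelfAdjoint.star_eq

theorem mul_supp (T : H →L[ℂ] H) : T * supp T = T := by
  rw [supp, mul_sub, mul_kerProj, mul_one, sub_zero]

theorem supp_mul {T y : H →L[ℂ] H} (h : T * y = 0) : supp T * y = 0 := by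
  rw [supp, sub_mul, kerProj_mul h, one_mul, sub_self]

theorem supp_mem {N : VonNeumannAlgebra H} {T : H →L[ℂ] H} (hT : T ∈ N) : supp T ∈ posCone N :=
  ⟨sub_mem (one_mem N) (kerProj_mem hT).1, (isStarProjection_supp T).nonneg⟩

/-- The support of `T` is the least projection whose kernel lies in the kernel of `T`. -/
theorem supp_le_of_ker_le {T p : H →L[ℂ] H} (hp : IsStarProjection p)
    (h : ∀ v, p v = 0 → T v = 0) : supp T ≤ p := by
  have h1 : T * (1 - p) = 0 := by
    ext v
    exact h _ (congrArg (fun A : H →L[ℂ] H => A v) hp.mul_one_sub_self)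
  have h2 := supp_mul h1
  rw [mul_sub, mul_one, sub_eq_zero] at h2
  exact ((isStarProjection_supp T).le_iff_mul_eq_left hp).2 h2.symm

/-- A positive operator that acts as the scalar `r` on the range of `c` dominates `r • supp c`. -/
theorem smul_supp_le {c g : H →L[ℂ] H} {r : ℝ} (hc : IsSelfAdjoint c) (hg : 0 ≤ g)
    (h : g * c = r • c) : r • supp c ≤ g := by
  have hgs : star g = g := (IsSelfAdjoint.of_nonneg hg).star_eq
  have h1 : c * (g - r • 1) = 0 := by
    have := congrArg star h
    rw [star_mul, star_smul, hc.star_eq, hgs] at this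
    simp [mul_sub, this]
  have h2 : supp c * g = r • supp c := by
    have := supp_mul h1
    rw [mul_sub, sub_eq_zero] at this
    simpa using this
  have h3 : g * supp c = r • supp c := by
    have := congrArg star h2
    rwa [star_mul, star_smul, star_supp, hgs] at this
  have h4 : g - r • supp c = (1 - supp c) * g * star (1 - supp c) := by
    rw [star_sub, star_one, star_supp]
    simp only [sub_mul, one_mul, mul_sub, mul_one, h2, h3, smul_mul_assoc, supp_mul_supp]
    abel
  rw [← sub_nonneg, h4]
  exact star_right_conjugate_nonneg hg _

/-- A positive operator `r ≤ m` that vanishes on `ker c` is dominated by `m • supp c`. -/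
theorem le_smul_supp {c r : H →L[ℂ] H} {m : ℝ} (hr : 0 ≤ r) (hm : r ≤ m • 1)
    (h : ∀ v, c v = 0 → r v = 0) : r ≤ m • supp c := by
  have h1 : r * kerProj c = 0 := by
    ext v
    exact h _ (congrArg (fun A : H →L[ℂ] H => A v) (mul_kerProj c))
  have h2 : r * supp c = r := by rw [supp, mul_sub, h1, mul_one, sub_zero]
  have h3 : supp c * r = r := by
    have := congrArg star h2
    rwa [star_mul, star_supp, (IsSelfAdjoint.of_nonneg hr).star_eq] at this
  have h4 := star_right_conjugate_le_conjugate hm (supp c)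
  rw [star_supp, h3, h2] at h4
  simpa [supp_mul_supp] using h4

end Supports

/-! ### Polar decomposition inside a von Neumann algebra. -/

section Polar

variable {H : Type*} [NormedAddCommGroup H] [InnerProductSpace ℂ H] [CompleteSpace H]

/-- If `‖T v‖ = ‖A v‖` for all `v`, then `T` factors through the self-adjoint operator `A`. -/
theorem exists_mul_eq_of_norm_eq {A T : H →L[ℂ] H} (h : ∀ v, ‖T v‖ = ‖A v‖) :
    ∃ u : H →L[ℂ] H, u * A = T := by
  let K := A.range.topologicalClosure
  have : CompleteSpace K := (Submodule.isClosed_topologicalClosure _).completeSpace_coe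
  have hK : ∀ v, A v ∈ K := fun v => Submodule.le_topologicalClosure _ ⟨v, rfl⟩
  let j : H →ₗ[ℂ] K := (A : H →ₗ[ℂ] H).codRestrict K hK
  have hd : DenseRange j := by
    intro x
    rw [Metric.mem_closure_iff]
    intro ε hε
    obtain ⟨_, ⟨v, rfl⟩, hv⟩ := Metric.mem_closure_iff.1
      (show (x : H) ∈ closure (A.range : Set H) from x.2) ε hε
    exact ⟨j v, ⟨v, rfl⟩, hv⟩
  refine ⟨((T : H →ₗ[ℂ] H).extendOfNorm j).comp K.orthogonalProjectionOnto, ?_⟩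
  ext v
  have h1 : K.orthogonalProjectionOnto (A v) = j v :=
    Submodule.orthogonalProjectionOnto_mem_subspace_eq_self (⟨A v, hK v⟩ : K)
  change (T : H →ₗ[ℂ] H).extendOfNorm j (K.orthogonalProjectionOnto (A v)) = T v
  rw [h1, LinearMap.extendOfNorm_eq hd ⟨1, fun v => by simpa using! (h v).le⟩]
  rfl

theorem norm_sq_eq_re_inner (T : H →L[ℂ] H) (v : H) :
    ‖T v‖ ^ 2 = RCLike.re (inner ℂ ((star T * T) v) v) :=
  ContinuousLinearMap.apply_norm_sq_eq_inner_adjoint_left T v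

theorem norm_abs_apply (T : H →L[ℂ] H) (v : H) : ‖CFC.abs T v‖ = ‖T v‖ := by
  rw [← sq_eq_sq₀ (norm_nonneg _) (norm_nonneg _), norm_sq_eq_re_inner, norm_sq_eq_re_inner,
    (IsSelfAdjoint.of_nonneg (CFC.abs_nonneg T)).star_eq, CFC.abs_mul_abs]

/-- Polar decomposition in a von Neumann algebra. -/
theorem exists_polar {N : VonNeumannAlgebra H} {T : H →L[ℂ] H} (hT : T ∈ N) :
    ∃ u ∈ N, u * CFC.abs T = T ∧ star u * u = supp T ∧ u * star u = supp (star T) ∧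
      u * star u * u = u := by
  set A := CFC.abs T with hA
  have hAsa : star A = A := (IsSelfAdjoint.of_nonneg (CFC.abs_nonneg T)).star_eq
  have hAN : A ∈ N := sqrt_mem (mul_mem (star_mem hT) hT)
  have hAA : A * A = star T * T := CFC.abs_mul_abs T
  have hnorm : ∀ v, ‖T v‖ = ‖A v‖ := fun v => (norm_abs_apply T v).symm
  obtain ⟨w, hw⟩ := exists_mul_eq_of_norm_eq hnorm
  have hsA : supp A * A = A := by
    have := congrArg star (mul_supp A)
    rwa [star_mul, star_supp, hAsa] at this
  -- As `A` is self-adjoint, `supp A` projects onto the closure of its range, so identities need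
  -- checking only after multiplication by `A` on the right.
  have hcancel : ∀ z : H →L[ℂ] H, z * A = 0 → z * supp A = 0 := by
    intro z hz
    have h1 := congrArg star hz
    rw [star_mul, hAsa, star_zero] at h1
    have h2 := congrArg star (supp_mul h1)
    rwa [star_mul, star_supp, star_star, star_zero] at h2
  have hsT : supp A = supp T := by
    have : ∀ v, A v = 0 ↔ T v = 0 := fun v => by
      rw [← norm_eq_zero, ← hnorm, norm_eq_zero]
    exact le_antisymm
      (supp_le_of_ker_le (isStarProjection_supp T) fun v hv => by
        rw [this, ← mul_supp T]; exact (congrArg T hv).trans (map_zero T))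
      (supp_le_of_ker_le (isStarProjection_supp A) fun v hv => by
        rw [← this, ← mul_supp A]; exact (congrArg A hv).trans (map_zero A))
  -- The relation `w * A = T` says nothing about `w` on `ker A`. Cutting with `supp A` makes `u`
  -- vanish there, which determines it uniquely.
  obtain ⟨u, hu⟩ : ∃ u, u = w * supp A := ⟨_, rfl⟩
  have huA : u * A = T := by rw [hu, mul_assoc, hsA, hw]
  have hus : u * supp A = u := by rw [hu, mul_assoc, supp_mul_supp]
  have hsu : supp A * star u = star u := by
    have := congrArg star hus
    rwa [star_mul, star_supp] at this
  have hAu : A * star u = star T := by rw [← huA, star_mul, hAsa]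
  have huu : star u * u = supp A := by
    have h1 : A * (star u * u * A - A) = 0 := by
      rw [mul_sub, ← mul_assoc, ← mul_assoc, hAu, mul_assoc, huA, hAA, sub_self]
    have h2 : star u * u * A = A := by
      have := supp_mul h1
      rw [mul_sub, hsA, sub_eq_zero] at this
      rwa [mul_assoc (star u), ← mul_assoc (supp A), hsu, ← mul_assoc] at this
    have h3 := hcancel (star u * u - 1) (by rw [sub_mul, h2, one_mul, sub_self])
    rwa [sub_mul, one_mul, mul_assoc, hus, sub_eq_zero] at h3
  -- For `y` in the commutant, `u * y - y * u` kills the range of `A`, since `y` commutes with `A`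
  -- and with `T = u * A`; it also kills `ker A`.
  have huN : u ∈ N := by
    refine mem_of_commute fun y hy => ?_
    have hyA := commute_of_mem hAN hy
    have hyT := commute_of_mem hT hy
    have hys := commute_of_mem (supp_mem hAN).1 hy
    have h1 := hcancel (u * y - y * u) (by
      rw [sub_mul, mul_assoc, ← hyA.eq, ← mul_assoc, huA, hyT.eq, mul_assoc, huA, sub_self])
    rw [sub_mul, mul_assoc, ← hys.eq, ← mul_assoc, hus, mul_assoc, hus, sub_eq_zero] at h1
    exact h1
  refine ⟨u, huN, huA, huu.trans hsT, ?_, by rw [mul_assoc, huu, hus]⟩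
  have h1 : star T * (1 - u * star u) = 0 := by
    rw [mul_sub, mul_one, ← hAu, mul_assoc A, ← mul_assoc (star u), huu, hsu, sub_self]
  have h2 : u * star u * kerProj (star T) = 0 := by
    have h3 : A * (star u * kerProj (star T)) = 0 := by rw [← mul_assoc, hAu, mul_kerProj]
    have h4 := supp_mul h3
    rw [← mul_assoc, hsu] at h4
    rw [mul_assoc, h4, mul_zero]
  have h5 := supp_mul h1
  have h6 := congrArg star h2
  simp only [star_mul, star_star, star_zero,
    (isStarProjection_kerProj (star T)).isSelfAdjoint.star_eq] at h6
  rw [mul_sub, mul_one, sub_eq_zero] at h5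
  rw [h5, supp, sub_mul, one_mul, h6, sub_zero]

end Polar

/-! ### Membership in `N` and in its positive cone. -/

section Calculus

variable {H : Type*} [NormedAddCommGroup H] [InnerProductSpace ℂ H] [CompleteSpace H]

theorem abs_mem {N : VonNeumannAlgebra H} {x : H →L[ℂ] H} (hx : x ∈ N) : CFC.abs x ∈ N :=
  sqrt_mem (mul_mem (star_mem hx) hx)

theorem cfc_mem {N : VonNeumannAlgebra H} {x : H →L[ℂ] H} (hx : x ∈ N) (f : ℝ → ℝ) :
    cfc f x ∈ N :=
  mem_of_commute fun _ hy => (commute_of_mem hx hy).cfc_real f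

/-- The quadratic forms give `‖A^{1/2} v‖² = ⟨A v, v⟩ ≤ ⟨B v, v⟩ = 0`. -/
theorem apply_eq_zero_of_le {A B : H →L[ℂ] H} (hA : 0 ≤ A) (h : A ≤ B) {v : H} (hv : B v = 0) :
    A v = 0 := by
  have h1 := re_inner_le_of_le h v
  rw [hv, inner_zero_left, map_zero] at h1
  have h2 := norm_sq_eq_re_inner (CFC.sqrt A) v
  rw [(IsSelfAdjoint.of_nonneg (CFC.sqrt_nonneg A)).star_eq, CFC.sqrt_mul_sqrt_self _ hA] at h2
  rw [← h2] at h1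
  rw [← CFC.sqrt_mul_sqrt_self _ hA]
  exact mul_apply_eq_zero
    (norm_eq_zero.1 (pow_eq_zero_iff two_ne_zero |>.1 (le_antisymm h1 (sq_nonneg _))))

theorem apply_eq_zero_of_supp {T : H →L[ℂ] H} {v : H} (h : supp T v = 0) : T v = 0 := by
  rw [← mul_supp T]
  exact mul_apply_eq_zero h

theorem cfc_mem_posCone {N : VonNeumannAlgebra H} {x : H →L[ℂ] H} (hx : x ∈ N) {f : ℝ → ℝ}
    (hf : ∀ t ∈ spectrum ℝ x, 0 ≤ f t) : cfc f x ∈ posCone N :=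
  ⟨cfc_mem hx f, cfc_nonneg hf⟩

theorem conj_mem_posCone {N : VonNeumannAlgebra H} {x u : H →L[ℂ] H} (hx : x ∈ posCone N)
    (hu : u ∈ N) : u * x * star u ∈ posCone N :=
  ⟨mul_mem (mul_mem hu hx.1) (star_mem hu), star_right_conjugate_nonneg hx.2 u⟩

theorem star_mul_self_mem_posCone {N : VonNeumannAlgebra H} {x : H →L[ℂ] H} (hx : x ∈ N) :
    star x * x ∈ posCone N :=
  ⟨mul_mem (star_mem hx) hx, star_mul_self_nonneg x⟩

theorem real_smul_mem {N : VonNeumannAlgebra H} (r : ℝ) {x : H →L[ℂ] H} (hx : x ∈ N) :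
    r • x ∈ N := by
  rw [← Complex.coe_smul]; exact smul_mem N _ hx

theorem real_smul_mem_posCone {N : VonNeumannAlgebra H} {r : ℝ} (hr : 0 ≤ r) {x : H →L[ℂ] H}
    (hx : x ∈ posCone N) : r • x ∈ posCone N :=
  ⟨real_smul_mem r hx.1, smul_nonneg hr hx.2⟩

end Calculus

/-! ### Spanning by unitaries, which turns unitary invariance into the trace property. -/

section Unitaries

variable {H : Type*} [NormedAddCommGroup H] [InnerProductSpace ℂ H] [CompleteSpace H]

open scoped ComplexStarModule in
/-- A von Neumann algebra is spanned by its unitary elements. -/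
theorem mem_span_unitary {N : VonNeumannAlgebra H} {x : H →L[ℂ] H} (hx : x ∈ N) :
    x ∈ Submodule.span ℂ {u | u ∈ N ∧ u ∈ unitary (H →L[ℂ] H)} := by
  rcases eq_or_ne x 0 with rfl | h0
  · exact zero_mem _
  have key := CStarAlgebra.norm_smul_two_inv_smul_add_four_unitary x h0
  simp only at key
  have hxN : ‖x‖⁻¹ • x ∈ N := real_smul_mem _ hx
  have hre : ((ℜ (‖x‖⁻¹ • x) : selfAdjoint (H →L[ℂ] H)) : H →L[ℂ] H) ∈ N := by
    rw [realPart_apply_coe]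
    exact real_smul_mem _ (add_mem hxN (star_mem hxN))
  have him : ((ℑ (‖x‖⁻¹ • x) : selfAdjoint (H →L[ℂ] H)) : H →L[ℂ] H) ∈ N := by
    rw [imaginaryPart_apply_coe]
    exact smul_mem N _ (real_smul_mem _ (sub_mem hxN (star_mem hxN)))
  have hU : ∀ (a : selfAdjoint (H →L[ℂ] H)) (ha : ‖a‖ ≤ 1), (a : H →L[ℂ] H) ∈ N →
      ((selfAdjoint.unitarySelfAddISMul a ha : unitary (H →L[ℂ] H)) : H →L[ℂ] H) ∈ N := by
    intro a ha haN
    change (a : H →L[ℂ] H) + Complex.I • CFC.sqrt (1 - (a : H →L[ℂ] H) ^ 2) ∈ N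
    exact add_mem haN (smul_mem N _ (sqrt_mem (sub_mem (one_mem N) (pow_mem haN 2))))
  have hs : ∀ w : unitary (H →L[ℂ] H), (w : H →L[ℂ] H) ∈ N →
      ((w : H →L[ℂ] H) + star (w : H →L[ℂ] H)) ∈
      Submodule.span ℂ {u | u ∈ N ∧ u ∈ unitary (H →L[ℂ] H)} := fun w hw =>
    add_mem (Submodule.subset_span ⟨hw, w.2⟩)
      (Submodule.subset_span ⟨star_mem hw, Unitary.star_mem w.2⟩)
  rw [key, ← Complex.coe_smul, ← Complex.coe_smul]
  exact Submodule.smul_mem _ _ (Submodule.smul_mem _ _ (add_mem (hs _ (hU _ _ hre))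
    (Submodule.smul_mem _ _ (hs _ (hU _ _ him)))))

end Unitaries

/-! ### Order on the extended values of the trace. -/

section Order

variable {X : Type*} [MeasurableSpace X] {ν : Measure X}

theorem aeeqFun_le_add (f g : X →ₘ[ν] ℝ≥0∞) : f ≤ f + g := by
  rw [← AEEqFun.coeFn_le]
  filter_upwards [AEEqFun.coeFn_add f g] with a h
  rw [h]
  exact le_self_add

theorem aeeqFun_add_le_add {f f' g g' : X →ₘ[ν] ℝ≥0∞} (h : f ≤ f') (k : g ≤ g') :
    f + g ≤ f' + g' := by
  rw [← AEEqFun.coeFn_le] at *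
  filter_upwards [AEEqFun.coeFn_add f g, AEEqFun.coeFn_add f' g', h, k] with a h1 h2 h3 h4
  rw [h1, h2]
  exact add_le_add h3 h4

theorem valMul_mono (f : X →ₘ[ν] ℝ≥0∞) {g g' : X →ₘ[ν] ℝ≥0∞} (h : g ≤ g') :
    valMul f g ≤ valMul f g' := by
  rw [← AEEqFun.coeFn_le] at *
  filter_upwards [h, AEEqFun.coeFn_comp₂Measurable (fun a b : ℝ≥0∞ => a * b) measurable_mul f g,
    AEEqFun.coeFn_comp₂Measurable (fun a b : ℝ≥0∞ => a * b) measurable_mul f g'] with a h1 h2 h3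
  rw [valMul, valMul, h2, h3]
  exact mul_le_mul_right h1 _

end Order

/-! ### The ideal of definition and the linear trace on it. -/

section Trace

variable {H : Type*} [NormedAddCommGroup H] [InnerProductSpace ℂ H] [CompleteSpace H]
variable {X : Type*} [MeasurableSpace X] {N Z : VonNeumannAlgebra H} {ν : Measure X}

/-- This makes finiteness hereditary: a bound on the value suffices. The essentially bounded class
`√f` is the image of some `w` in `Z`, and `star w * w` is then a preimage of `f` that is visibly
positive. -/
theorem exists_pos_eq_of_le {e : LInftyIso Z ν} {f : X →ₘ[ν] ℝ≥0∞} {z : posCone Z}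
    (h : f ≤ e.pos z) : ∃ z' : posCone Z, f = e.pos z' := by
  have hb : eLpNorm (e.toFun ⟨z, z.2.1⟩) ∞ ν < ∞ := by
    have : e.toFun ⟨z, z.2.1⟩ ∈ (Lp ℂ ∞ ν : Set (X →ₘ[ν] ℂ)) := e.range_eq ▸ ⟨_, rfl⟩
    exact Lp.mem_Lp_iff_eLpNorm_lt_top.1 this
  let g : X →ₘ[ν] ℂ := AEEqFun.compMeasurable (fun t : ℝ≥0∞ => ((√t.toReal : ℝ) : ℂ))
    (by fun_prop) f
  have hg : g =ᵐ[ν] fun a => ((√(f a).toReal : ℝ) : ℂ) := AEEqFun.coeFn_compMeasurable _ _ _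
  rw [← AEEqFun.coeFn_le] at h
  have hfin : ∀ᵐ a ∂ν, f a < ∞ := by
    filter_upwards [h, e.coeFn_pos z] with a h1 h2
    exact h1.trans_lt (h2 ▸ ENNReal.ofReal_lt_top)
  have hgL : g ∈ (Lp ℂ ∞ ν : Set (X →ₘ[ν] ℂ)) := by
    refine Lp.mem_Lp_iff_memLp.2 (memLp_top_of_bound g.aestronglyMeasurable
      (√(eLpNorm (e.toFun ⟨z, z.2.1⟩) ∞ ν).toReal) ?_)
    rw [eLpNorm_exponent_top] at hb ⊢
    filter_upwards [hg, h, e.coeFn_pos z, hfin,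
      ae_le_eLpNormEssSup (f := e.toFun ⟨z, z.2.1⟩) (μ := ν)]
      with a h1 h2 h3 h4 h5
    rw [h1, Complex.norm_real, Real.norm_of_nonneg (Real.sqrt_nonneg _)]
    refine Real.sqrt_le_sqrt (ENNReal.toReal_mono hb.ne (h2.trans (h3.le.trans (le_trans ?_ h5))))
    rw [← ofReal_norm]
    exact ENNReal.ofReal_le_ofReal (Complex.re_le_norm _)
  obtain ⟨w, hw⟩ := e.range_eq.symm ▸ hgL
  refine ⟨⟨_, star_mul_self_mem_posCone w.2⟩, AEEqFun.ext ?_⟩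
  have h1 := e.coeFn_pos ⟨_, star_mul_self_mem_posCone w.2⟩
  have h2 : e.toFun ⟨star (w : H →L[ℂ] H) * w, (star_mul_self_mem_posCone w.2).1⟩ =
      star (e.toFun w) * e.toFun w := by
    rw [← e.map_star, ← e.map_mul]; rfl
  rw [h2, hw] at h1
  filter_upwards [h1, hg, hfin, AEEqFun.coeFn_mul (star g) g, AEEqFun.coeFn_star g]
    with a k1 k2 k3 k4 k5
  rw [k1, k4, Pi.mul_apply, k5, Pi.star_apply, k2]
  simp only [RCLike.star_def, Complex.conj_ofReal]
  rw [← Complex.ofReal_mul, Complex.ofReal_re, Real.mul_self_sqrt ENNReal.toReal_nonneg,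
    ENNReal.ofReal_toReal k3.ne]

namespace ZTrace

variable {e : LInftyIso Z ν} (φ : ZTrace N Z e)

open Classical in
/-- The value of the trace on a positive operator of `N` (and `0` elsewhere). -/
def val (x : H →L[ℂ] H) : X →ₘ[ν] ℝ≥0∞ :=
  if hx : x ∈ posCone N then φ.toFun ⟨x, hx⟩ else 0

variable {φ}

theorem val_of_mem {x : H →L[ℂ] H} (hx : x ∈ posCone N) : φ.val x = φ.toFun ⟨x, hx⟩ :=
  dif_pos hx

theorem val_add {x y : H →L[ℂ] H} (hx : x ∈ posCone N) (hy : y ∈ posCone N) :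
    φ.val (x + y) = φ.val x + φ.val y := by
  rw [val_of_mem hx, val_of_mem hy, val_of_mem (add_mem hx hy), ← φ.map_add]; rfl

theorem val_mono {x y : H →L[ℂ] H} (hx : x ∈ posCone N) (hy : y ∈ posCone N) (h : x ≤ y) :
    φ.val x ≤ φ.val y := by
  have h1 : y - x ∈ posCone N := ⟨sub_mem hy.1 hx.1, sub_nonneg.2 h⟩
  rw [← add_sub_cancel x y, val_add hx h1]
  exact aeeqFun_le_add _ _

theorem val_smul_mono {x y : H →L[ℂ] H} (hx : x ∈ posCone N) (hy : y ∈ posCone N) {r : ℝ}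
    (hr : 0 ≤ r) (h : φ.val x ≤ φ.val y) : φ.val (r • x) ≤ φ.val (r • y) := by
  have h1 : (1 : H →L[ℂ] H) ∈ posCone Z := ⟨one_mem Z, zero_le_one⟩
  have key : ∀ x (hx : x ∈ posCone N), φ.val (r • x) =
      valMul (e.pos ⟨_, real_smul_mem_posCone hr h1⟩) (φ.val x) := by
    intro x hx
    rw [val_of_mem hx, val_of_mem (real_smul_mem_posCone hr hx)]
    exact φ.map_mul _ _ _ (by simp)
  rw [key x hx, key y hy]
  exact valMul_mono _ h

theorem val_sum_mono {ι : Type*} (s : Finset ι) {x y : ι → H →L[ℂ] H}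
    (hx : ∀ i ∈ s, x i ∈ posCone N) (hy : ∀ i ∈ s, y i ∈ posCone N)
    (h : ∀ i ∈ s, φ.val (x i) ≤ φ.val (y i)) :
    φ.val (∑ i ∈ s, x i) ≤ φ.val (∑ i ∈ s, y i) := by
  classical
  induction s using Finset.induction_on with
  | empty => simp
  | insert i s hi ih =>
    rw [Finset.sum_insert hi, Finset.sum_insert hi]
    simp only [Finset.mem_insert, forall_eq_or_imp] at hx hy h
    rw [val_add hx.1 (sum_mem hx.2), val_add hy.1 (sum_mem hy.2)]
    exact aeeqFun_add_le_add h.1 (ih hx.2 hy.2 h.2)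

theorem IsFinite.mem {x : H →L[ℂ] H} (h : φ.IsFinite x) : x ∈ posCone N := h.1

theorem isFinite_iff {x : H →L[ℂ] H} :
    φ.IsFinite x ↔ x ∈ posCone N ∧ ∃ z : posCone Z, φ.val x ≤ e.pos z := by
  constructor
  · rintro ⟨hx, z, h⟩
    exact ⟨hx, z, by rw [val_of_mem hx, h]⟩
  · rintro ⟨hx, z, h⟩
    obtain ⟨z', h'⟩ := exists_pos_eq_of_le h
    exact ⟨hx, z', by rw [← val_of_mem hx, h']⟩

theorem IsFinite.of_val_le {x y : H →L[ℂ] H} (hy : φ.IsFinite y) (hx : x ∈ posCone N)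
    (h : φ.val x ≤ φ.val y) : φ.IsFinite x := by
  obtain ⟨-, z, hz⟩ := isFinite_iff.1 hy
  exact isFinite_iff.2 ⟨hx, z, h.trans hz⟩

theorem IsFinite.of_le {x y : H →L[ℂ] H} (hy : φ.IsFinite y) (hx : x ∈ posCone N)
    (h : x ≤ y) : φ.IsFinite x :=
  hy.of_val_le hx (val_mono hx hy.mem h)

theorem IsFinite.add {x y : H →L[ℂ] H} (hx : φ.IsFinite x) (hy : φ.IsFinite y) :
    φ.IsFinite (x + y) := by
  obtain ⟨hx, z, h⟩ := hx
  obtain ⟨hy, w, k⟩ := hy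
  exact ⟨add_mem hx hy, z + w, by
    rw [e.pos_add, ← h, ← k, ← φ.map_add]; rfl⟩

theorem IsFinite.smul {x : H →L[ℂ] H} (hx : φ.IsFinite x) {r : ℝ} (hr : 0 ≤ r) :
    φ.IsFinite (r • x) := by
  obtain ⟨hx, z, h⟩ := hx
  obtain ⟨y, w, k, l⟩ := φ.smul_mem_posGraph hr ⟨⟨x, hx⟩, z, h, rfl⟩
  have hy : (y : H →L[ℂ] H) = r • x := by
    rw [← Complex.coe_smul]; exact (congrArg Prod.fst l).symm
  rw [← hy]
  exact ⟨y.2, w, k⟩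

theorem IsFinite.conj {x u : H →L[ℂ] H} (hx : φ.IsFinite x) (hu : u ∈ N)
    (hu' : u ∈ unitary (H →L[ℂ] H)) : φ.IsFinite (u * x * star u) := by
  obtain ⟨hx, z, h⟩ := hx
  exact ⟨conj_mem_posCone hx hu, z, (φ.map_conj u hu hu' ⟨x, hx⟩).trans h⟩

theorem IsFinite.mem_ideal {x : H →L[ℂ] H} (hx : φ.IsFinite x) : x ∈ φ.ideal :=
  Submodule.subset_span hx

theorem mem_of_mem_ideal {x : H →L[ℂ] H} (hx : x ∈ φ.ideal) : x ∈ N := by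
  refine Submodule.span_induction (p := fun x _ => x ∈ N) (fun x hx => hx.mem.1) (zero_mem N)
    (fun x y _ _ hx hy => add_mem hx hy) (fun c x _ hx => smul_mem N c hx) hx

theorem star_mem_ideal {x : H →L[ℂ] H} (hx : x ∈ φ.ideal) : star x ∈ φ.ideal := by
  refine Submodule.span_induction (p := fun x _ => star x ∈ φ.ideal) (fun x hx => ?_) ?_
    (fun x y _ _ hx hy => ?_) (fun c x _ hx => ?_) hx
  · rw [(IsSelfAdjoint.of_nonneg hx.mem.2).star_eq]
    exact hx.mem_ideal
  · rw [star_zero]; exact zero_mem _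
  · rw [star_add]; exact add_mem hx hy
  · rw [star_smul]; exact Submodule.smul_mem _ _ hx

/-- Polarization: the product of two square-summable operators lies in the ideal of definition. -/
theorem star_mul_mem_ideal {p q : H →L[ℂ] H} (hp : p ∈ N) (hq : q ∈ N)
    (hp' : φ.IsFinite (star p * p)) (hq' : φ.IsFinite (star q * q)) : star p * q ∈ φ.ideal := by
  have key : ∀ c : ℂ, star c * c = 1 → φ.IsFinite (star (p + c • q) * (p + c • q)) := by
    intro c hc
    have hm : ∀ c : ℂ, p + c • q ∈ N := fun c => add_mem hp (smul_mem N c hq)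
    refine ((hp'.add hq').smul (zero_le_two (α := ℝ))).of_le (star_mul_self_mem_posCone (hm c)) ?_
    -- The parallelogram identity, valid because `c` has modulus one.
    have h1 : (2 : ℝ) • (star p * p + star q * q) - star (p + c • q) * (p + c • q) =
        star (p + (-c) • q) * (p + (-c) • q) := by
      simp only [star_add, star_smul, add_mul, mul_add, star_neg, neg_mul, mul_neg,
        smul_mul_assoc, mul_smul_comm, neg_smul]
      match_scalars <;> first | ring1 | linear_combination (-2) * hc
    rw [← sub_nonneg, h1]
    exact star_mul_self_nonneg _
  have h4 : star p * q = (4 : ℂ)⁻¹ • (star (p + (1 : ℂ) • q) * (p + (1 : ℂ) • q)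
      - star (p + (-1 : ℂ) • q) * (p + (-1 : ℂ) • q)
      - Complex.I • (star (p + Complex.I • q) * (p + Complex.I • q))
      + Complex.I • (star (p + (-Complex.I) • q) * (p + (-Complex.I) • q))) := by
    simp only [star_add, star_smul, add_mul, mul_add, star_neg, smul_mul_assoc, mul_smul_comm,
      star_one, RCLike.star_def, Complex.conj_I]
    have hI : Complex.I * Complex.I = -1 := Complex.I_mul_I
    match_scalars <;> ring_nf <;> norm_num
  rw [h4]
  refine Submodule.smul_mem _ _ (add_mem (sub_mem (sub_mem (key 1 ?_).mem_ideal
    (key (-1) ?_).mem_ideal) (Submodule.smul_mem _ _ (key _ ?_).mem_ideal))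
    (Submodule.smul_mem _ _ (key _ ?_).mem_ideal)) <;> simp

/-- By linearity `b` is a unitary `u` and `x` is positive and finite. Then `u x = (x^{1/2} u*)*
x^{1/2}`, and the associated squares `u x u*` and `x` are both finite, so polarization applies. -/
theorem mul_mem_ideal_left {x b : H →L[ℂ] H} (hx : x ∈ φ.ideal) (hb : b ∈ N) :
    b * x ∈ φ.ideal := by
  refine Submodule.span_induction (p := fun b _ => b * x ∈ φ.ideal) (fun u hu => ?_)
    (by rw [zero_mul]; exact zero_mem _)
    (fun a b _ _ ha hb => by rw [add_mul]; exact add_mem ha hb)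
    (fun c b _ hb => by rw [smul_mul_assoc]; exact Submodule.smul_mem _ _ hb) (mem_span_unitary hb)
  refine Submodule.span_induction (p := fun x _ => u * x ∈ φ.ideal) (fun x hx => ?_)
    (by rw [mul_zero]; exact zero_mem _)
    (fun a b _ _ ha hb => by rw [mul_add]; exact add_mem ha hb)
    (fun c b _ hb => by rw [mul_smul_comm]; exact Submodule.smul_mem _ _ hb) hx
  have hs : star (CFC.sqrt x) = CFC.sqrt x := (IsSelfAdjoint.of_nonneg (CFC.sqrt_nonneg x)).star_eq
  have hss : CFC.sqrt x * CFC.sqrt x = x := CFC.sqrt_mul_sqrt_self x hx.mem.2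
  have hsN := sqrt_mem hx.mem.1
  have h1 : u * x = star (CFC.sqrt x * star u) * CFC.sqrt x := by
    rw [star_mul, star_star, hs, mul_assoc, hss]
  rw [h1]
  refine star_mul_mem_ideal (mul_mem hsN (star_mem hu.1)) hsN ?_ (by rwa [hs, hss])
  have h2 : star (CFC.sqrt x * star u) * (CFC.sqrt x * star u) = u * x * star u := by
    rw [← mul_assoc, ← h1]
  rw [h2]
  exact hx.conj hu.1 hu.2

theorem mul_mem_ideal_right {x b : H →L[ℂ] H} (hx : x ∈ φ.ideal) (hb : b ∈ N) :
    x * b ∈ φ.ideal := by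
  have := star_mem_ideal (mul_mem_ideal_left (star_mem_ideal hx) (star_mem hb))
  rwa [star_mul, star_star, star_star] at this

/-- In a decomposition of `x` into four finite positive operators the imaginary part drops out,
leaving `x = x₁ - x₂ ≤ x₁`. -/
theorem isFinite_of_mem_ideal {x : H →L[ℂ] H} (hx : x ∈ φ.ideal) (h0 : 0 ≤ x) :
    φ.IsFinite x := by
  obtain ⟨_, ⟨x₁, z₁, h₁, rfl⟩, _, ⟨x₂, z₂, h₂, rfl⟩, _, ⟨x₃, z₃, h₃, rfl⟩, _, ⟨x₄, z₄, h₄, rfl⟩,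
    hq⟩ := φ.exists_of_mem_traceGraph (φ.mk_tr_mem_traceGraph hx)
  have hsa : ∀ x : posCone N, star (x : H →L[ℂ] H) = x := fun x =>
    (IsSelfAdjoint.of_nonneg x.2.2).star_eq
  have hc : x = (x₁ : H →L[ℂ] H) - x₂ + Complex.I • ((x₃ : H →L[ℂ] H) - x₄) := congrArg Prod.fst hq
  have hs := congrArg star hc
  simp only [star_add, star_sub, star_smul, hsa, RCLike.star_def, Complex.conj_I,
    (IsSelfAdjoint.of_nonneg h0).star_eq] at hs
  have h12 : x = (x₁ : H →L[ℂ] H) - x₂ := by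
    have h2 : (2 : ℂ) • x = (2 : ℂ) • ((x₁ : H →L[ℂ] H) - x₂) := by
      rw [two_smul ℂ x]
      nth_rewrite 1 [hc]
      rw [hs]
      module
    exact smul_right_injective _ two_ne_zero h2
  have hf : φ.IsFinite (x₁ : H →L[ℂ] H) := ⟨x₁.2, z₁, h₁⟩
  exact hf.of_le ⟨mem_of_mem_ideal hx, h0⟩ (by rw [h12]; exact sub_le_self _ x₂.2.2)

theorem tr_eq_of_mem_traceGraph {x : H →L[ℂ] H} {z : Z.toStarSubalgebra}
    (h : (x, z) ∈ φ.traceGraph) : φ.tr x = z := by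
  have hx : x ∈ φ.ideal := by
    rw [← φ.ext_domain]
    exact φ.ext.mem_domain_of_mem_graph (by rw [φ.ext_graph]; exact h)
  exact sub_eq_zero.1
    (φ.traceGraph_snd_eq_zero _ (sub_mem (φ.mk_tr_mem_traceGraph hx) h) (sub_self _))

theorem tr_add {x y : H →L[ℂ] H} (hx : x ∈ φ.ideal) (hy : y ∈ φ.ideal) :
    φ.tr (x + y) = φ.tr x + φ.tr y :=
  tr_eq_of_mem_traceGraph (add_mem (φ.mk_tr_mem_traceGraph hx) (φ.mk_tr_mem_traceGraph hy))

theorem tr_sub {x y : H →L[ℂ] H} (hx : x ∈ φ.ideal) (hy : y ∈ φ.ideal) :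
    φ.tr (x - y) = φ.tr x - φ.tr y :=
  tr_eq_of_mem_traceGraph (sub_mem (φ.mk_tr_mem_traceGraph hx) (φ.mk_tr_mem_traceGraph hy))

theorem tr_smul (c : ℂ) {x : H →L[ℂ] H} (hx : x ∈ φ.ideal) : φ.tr (c • x) = c • φ.tr x :=
  tr_eq_of_mem_traceGraph (φ.traceGraph.smul_mem c (φ.mk_tr_mem_traceGraph hx))

theorem tr_conj {x u : H →L[ℂ] H} (hx : x ∈ φ.ideal) (hu : u ∈ N)
    (hu' : u ∈ unitary (H →L[ℂ] H)) : φ.tr (u * x * star u) = φ.tr x := by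
  refine tr_eq_of_mem_traceGraph ?_
  refine Submodule.span_induction (p := fun q _ => (u * q.1 * star u, q.2) ∈ φ.traceGraph)
    ?_ ?_ ?_ ?_ (φ.mk_tr_mem_traceGraph hx)
  · rintro _ ⟨x, z, h, rfl⟩
    exact Submodule.subset_span ⟨conjBy u hu x, z, (φ.map_conj u hu hu' x).trans h, rfl⟩
  · simp only [Prod.fst_zero, mul_zero, zero_mul]; exact zero_mem _
  · intro p q _ _ hp hq
    simp only [Prod.fst_add, mul_add, add_mul]
    exact add_mem hp hq
  · intro c p _ hp
    simp only [Prod.smul_fst, mul_smul_comm, smul_mul_assoc]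
    exact φ.traceGraph.smul_mem c hp

/-- For a unitary `u` this is invariance under conjugation, as `u x = u (x u) u*`; unitaries span
`N`. -/
theorem tr_mul_comm {x b : H →L[ℂ] H} (hx : x ∈ φ.ideal) (hb : b ∈ N) :
    φ.tr (b * x) = φ.tr (x * b) := by
  have hmem : ∀ b ∈ Submodule.span ℂ {u | u ∈ N ∧ u ∈ unitary (H →L[ℂ] H)}, b ∈ N := by
    intro b hb
    exact Submodule.span_induction (p := fun b _ => b ∈ N) (fun u hu => hu.1) (zero_mem N)
      (fun a b _ _ ha hb => add_mem ha hb) (fun c b _ hb => smul_mem N c hb) hb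
  refine Submodule.span_induction (p := fun b _ => φ.tr (b * x) = φ.tr (x * b)) (fun u hu => ?_)
    (by rw [zero_mul, mul_zero]) (fun a b ha hb iha ihb => ?_) (fun c b hb ih => ?_)
    (mem_span_unitary hb)
  · have h := tr_conj (mul_mem_ideal_right hx hu.1) hu.1 hu.2
    rwa [mul_assoc, mul_assoc, Unitary.mul_star_self_of_mem hu.2, mul_one] at h
  · rw [add_mul, mul_add, tr_add (mul_mem_ideal_left hx (hmem a ha)) (mul_mem_ideal_left hx (hmem b hb)),
      tr_add (mul_mem_ideal_right hx (hmem a ha)) (mul_mem_ideal_right hx (hmem b hb)), iha, ihb]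
  · rw [smul_mul_assoc, mul_smul_comm, tr_smul c (mul_mem_ideal_left hx (hmem b hb)),
      tr_smul c (mul_mem_ideal_right hx (hmem b hb)), ih]

theorem val_eq_of_tr_eq {x y : H →L[ℂ] H} (hx : φ.IsFinite x) (hy : φ.IsFinite y)
    (h : φ.tr x = φ.tr y) : φ.val x = φ.val y := by
  obtain ⟨hx, z, hz⟩ := hx
  obtain ⟨hy, w, hw⟩ := hy
  have h1 : φ.tr x = ⟨z, z.2.1⟩ := φ.tr_of_pos hz
  have h2 : φ.tr y = ⟨w, w.2.1⟩ := φ.tr_of_pos hw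
  have h3 : z = w := Subtype.ext (Subtype.mk.inj (h1.symm.trans (h.trans h2)))
  rw [val_of_mem hx, val_of_mem hy, hz, hw, h3]

/-- The trace takes the same value on the initial and on the final projection of a partial
isometry, if the latter is finite. -/
theorem val_star_mul_self {u : H →L[ℂ] H} (hu : u ∈ N) (h : u * star u * u = u)
    (hf : φ.IsFinite (u * star u)) : φ.val (star u * u) = φ.val (u * star u) := by
  -- Writing `u* u` as `u* (u u*) u` places it in the ideal, so its finiteness follows from that of
  -- `u u*`.
  have h1 : star u * (u * star u * u) = star u * u := by rw [h]
  have h2 : u * star u * u ∈ φ.ideal := mul_mem_ideal_right hf.mem_ideal hu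
  have h3 : star u * u ∈ φ.ideal := h1 ▸ mul_mem_ideal_left h2 (star_mem hu)
  refine val_eq_of_tr_eq (isFinite_of_mem_ideal h3 (star_mul_self_nonneg u)) hf ?_
  rw [← h1, tr_mul_comm h2 (star_mem hu), h]

end ZTrace

end Trace

/-! ### Spectral truncations and dyadic layers. -/

section Cut

variable {H : Type*} [NormedAddCommGroup H] [InnerProductSpace ℂ H] [CompleteSpace H]

/-- The part `(a - t)₊` of a self-adjoint operator `a` above the level `t`. -/
def cut (a : H →L[ℂ] H) (t : ℝ) : H →L[ℂ] H := cfc (fun s : ℝ => max (s - t) 0) a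

theorem cut_nonneg (a : H →L[ℂ] H) (t : ℝ) : 0 ≤ cut a t :=
  cfc_nonneg fun _ _ => le_max_right _ _

theorem cut_mem {N : VonNeumannAlgebra H} {a : H →L[ℂ] H} (ha : a ∈ N) (t : ℝ) :
    cut a t ∈ posCone N :=
  ⟨cfc_mem ha _, cut_nonneg a t⟩

theorem cut_le_cut {a : H →L[ℂ] H} {s t : ℝ} (h : s ≤ t) : cut a t ≤ cut a s :=
  cfc_mono (fun x _ => max_le_max_right 0 (by linarith)) (by fun_prop) (by fun_prop)

theorem cut_le_self {a : H →L[ℂ] H} (ha : 0 ≤ a) {t : ℝ} (ht : 0 ≤ t) : cut a t ≤ a := by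
  have has : IsSelfAdjoint a := .of_nonneg ha
  conv_rhs => rw [← cfc_id ℝ a]
  exact cfc_mono (fun x hx => max_le (by simp only [id]; linarith) (spectrum_nonneg_of_nonneg ha hx))
    (by fun_prop) (by fun_prop)

theorem le_cut_add {a : H →L[ℂ] H} (ha : IsSelfAdjoint a) (t : ℝ) : a - t • 1 ≤ cut a t := by
  have : a - t • 1 = cfc (fun s : ℝ => s - t) a := by
    rw [cfc_sub .., cfc_id' .., cfc_const .., Algebra.algebraMap_eq_smul_one]
  rw [this]
  exact cfc_mono (fun x _ => le_max_left _ _) (by fun_prop) (by fun_prop)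

/-- On the spectrum `s² ≤ t² + (s + t) (s - t)₊`, and the last term vanishes at `v`. -/
theorem norm_apply_le_of_cut_eq_zero {a : H →L[ℂ] H} (ha : 0 ≤ a) {t : ℝ} (ht : 0 ≤ t) {v : H}
    (hv : cut a t v = 0) : ‖a v‖ ≤ t * ‖v‖ := by
  have has : IsSelfAdjoint a := .of_nonneg ha
  have h1 : a * a ≤ t ^ 2 • 1 + cfc (fun s : ℝ => s + t) a * cut a t := by
    have e1 : a * a = cfc (fun s : ℝ => s * s) a := by rw [cfc_mul .., cfc_id' ..]
    have e2 : t ^ 2 • 1 + cfc (fun s : ℝ => s + t) a * cut a t =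
        cfc (fun s : ℝ => t ^ 2 + (s + t) * max (s - t) 0) a := by
      rw [cut, ← cfc_mul .., ← Algebra.algebraMap_eq_smul_one, ← cfc_const (R := ℝ) (t ^ 2) a,
        ← cfc_add ..]
    rw [e1, e2]
    refine cfc_mono (fun x hx => ?_) (by fun_prop) (by fun_prop)
    have hx0 := spectrum_nonneg_of_nonneg ha hx
    nlinarith [le_max_left (x - t) 0]
  have h2 := re_inner_le_of_le h1 v
  have h3 := norm_sq_eq_re_inner a v
  rw [has.star_eq] at h3
  rw [← h3] at h2
  have h4 : (t ^ 2 • (1 : H →L[ℂ] H) + cfc (fun s : ℝ => s + t) a * cut a t) v = (t ^ 2 : ℝ) • v := by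
    change t ^ 2 • v + (cfc (fun s : ℝ => s + t) a) (cut a t v) = _
    rw [hv, map_zero, add_zero]
  rw [h4, re_inner_smul_self, ← mul_pow] at h2
  exact (abs_le_of_sq_le_sq' h2 (by positivity)).2

/-- Here `supp (cut a t)` is the spectral projection of `a` for `(t, ∞)`, obtained without Borel
calculus. The continuous function `min(s, t)²` separates `t²` times it from `a²`. -/
theorem le_norm_apply_of_supp_cut {a : H →L[ℂ] H} (ha : 0 ≤ a) {t : ℝ} (ht : 0 ≤ t) {v : H}
    (hv : supp (cut a t) v = v) : t * ‖v‖ ≤ ‖a v‖ := by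
  have has : IsSelfAdjoint a := .of_nonneg ha
  have h1 : t ^ 2 • supp (cut a t) ≤ a * a := by
    have h2 : t ^ 2 • supp (cut a t) ≤ cfc (fun s : ℝ => (min s t) ^ 2) a := by
      refine smul_supp_le (.of_nonneg (cut_nonneg a t)) (cfc_nonneg fun _ _ => sq_nonneg _) ?_
      rw [cut, ← cfc_mul .., ← cfc_const_mul ..]
      refine cfc_congr fun x _ => ?_
      rcases le_total x t with h | h
      · simp [max_eq_right (sub_nonpos.2 h)]
      · simp [min_eq_right h]
    have e1 : a * a = cfc (fun s : ℝ => s * s) a := by rw [cfc_mul .., cfc_id' ..]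
    refine h2.trans ?_
    rw [e1]
    refine cfc_mono (fun x hx => ?_) (by fun_prop) (by fun_prop)
    have hx0 := spectrum_nonneg_of_nonneg ha hx
    have := min_le_left x t
    have := le_min hx0 ht
    nlinarith
  have h2 := re_inner_le_of_le h1 v
  have h3 := norm_sq_eq_re_inner a v
  rw [has.star_eq] at h3
  rw [← h3] at h2
  have h4 : (t ^ 2 • supp (cut a t)) v = (t ^ 2 : ℝ) • v := by
    change t ^ 2 • (supp (cut a t) v) = _
    rw [hv]
  rw [h4, re_inner_smul_self, ← mul_pow] at h2
  exact (abs_le_of_sq_le_sq' h2 (norm_nonneg _)).2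

/-- Dyadic layers of `a ^ n` dominate the multiples of the spectral projections of `a`. -/
theorem sum_smul_supp_cut_le {a : H →L[ℂ] H} (ha : 0 ≤ a) (n K : ℕ) :
    ∑ k ∈ Finset.range K, ((((2 : ℝ)⁻¹ ^ n) ^ k) * (1 - (2 : ℝ)⁻¹ ^ n)) • supp (cut a ((2 : ℝ)⁻¹ ^ k))
      ≤ a ^ n := by
  have has : IsSelfAdjoint a := .of_nonneg ha
  -- Consecutive differences telescope. Each is nonnegative and is constant for `s ≥ 2 ^ (-k)`,
  -- where it equals the coefficient of the `k`-th projection.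
  let A : ℕ → H →L[ℂ] H := fun k => cfc (fun s : ℝ => (min s ((2 : ℝ)⁻¹ ^ k)) ^ n) a
  have hA : ∀ k, ((((2 : ℝ)⁻¹ ^ n) ^ k) * (1 - (2 : ℝ)⁻¹ ^ n)) • supp (cut a ((2 : ℝ)⁻¹ ^ k)) ≤
      A k - A (k + 1) := by
    intro k
    have hk : (2 : ℝ)⁻¹ ^ (k + 1) ≤ (2 : ℝ)⁻¹ ^ k :=
      pow_le_pow_of_le_one (by norm_num) (by norm_num) (Nat.le_succ k)
    refine smul_supp_le (.of_nonneg (cut_nonneg a _)) (sub_nonneg.2 (cfc_mono (fun x hx => ?_)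
      (by fun_prop) (by fun_prop))) ?_
    · have hx0 := spectrum_nonneg_of_nonneg ha hx
      exact pow_le_pow_left₀ (le_min hx0 (by positivity)) (min_le_min_left x hk) n
    · simp only [A]
      rw [cut, ← cfc_sub .., ← cfc_mul .., ← cfc_const_mul ..]
      refine cfc_congr fun x _ => ?_
      rcases le_total x ((2 : ℝ)⁻¹ ^ k) with h | h
      · simp only [max_eq_right (sub_nonpos.2 h), mul_zero]
      · simp only [min_eq_right h, min_eq_right (hk.trans h)]
        congr 1
        rw [← pow_mul, ← pow_mul, ← pow_mul, add_mul, pow_add, mul_comm n k, one_mul]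
        ring
  refine (Finset.sum_le_sum fun k _ => hA k).trans ?_
  rw [Finset.sum_range_sub']
  have h0 : A 0 ≤ a ^ n := by
    conv_rhs => rw [← cfc_pow_id (R := ℝ) a n]
    refine cfc_mono (fun x hx => ?_) (by fun_prop) (by fun_prop)
    have hx0 := spectrum_nonneg_of_nonneg ha hx
    exact pow_le_pow_left₀ (le_min hx0 (by positivity)) (min_le_left _ _) n
  have hK : 0 ≤ A K := cfc_nonneg fun x hx =>
    pow_nonneg (le_min (spectrum_nonneg_of_nonneg ha hx) (by positivity)) n
  exact (sub_le_self _ hK).trans h0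

/-- A positive operator is approximated from below by combinations of spectral projections. -/
theorem cut_le_sum_smul_supp_cut {y : H →L[ℂ] H} (hy : 0 ≤ y) {δ : ℝ} (h0 : 0 < δ) (h1 : δ ≤ 1)
    (K : ℕ) : cut y (2 * δ ^ K) ≤
      ∑ k ∈ Finset.range (K + 1), ((‖y‖ + 2 / δ) * δ ^ k) • supp (cut y (2 * δ ^ k)) := by
  have hys : IsSelfAdjoint y := .of_nonneg hy
  have hs : ∀ k, 0 ≤ supp (cut y (2 * δ ^ k)) := fun k => (isStarProjection_supp _).nonneg
  -- A layer is at most `2 δ ^ k = (2 / δ) δ ^ (k + 1)` in norm and lives on the support of the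
  -- lower cut. The summand `‖y‖` of the coefficient serves the top piece `k = 0`.
  have hstep : ∀ k, cut y (2 * δ ^ (k + 1)) - cut y (2 * δ ^ k) ≤
      ((‖y‖ + 2 / δ) * δ ^ (k + 1)) • supp (cut y (2 * δ ^ (k + 1))) := by
    intro k
    have hk : 2 * δ ^ (k + 1) ≤ 2 * δ ^ k := by
      have := pow_le_pow_of_le_one h0.le h1 (Nat.le_add_right k 1)
      linarith
    have hd : 0 ≤ cut y (2 * δ ^ (k + 1)) - cut y (2 * δ ^ k) := sub_nonneg.2 (cut_le_cut hk)
    have hp : 0 < δ ^ k := pow_pos h0 k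
    have hle : cut y (2 * δ ^ (k + 1)) - cut y (2 * δ ^ k) ≤ ((2 : ℝ) * δ ^ k) • 1 := by
      rw [cut, cut, ← cfc_sub .., ← Algebra.algebraMap_eq_smul_one]
      refine cfc_le_algebraMap _ _ _ fun x hx => ?_
      have hx0 := spectrum_nonneg_of_nonneg hy hx
      have hp' : 0 < δ ^ (k + 1) := pow_pos h0 _
      have h3 := le_max_left (x - 2 * δ ^ k) 0
      have h4 := le_max_right (x - 2 * δ ^ k) 0
      rw [sub_le_iff_le_add]
      exact max_le (by linarith) (by linarith)
    refine (le_smul_supp hd hle fun v hv => ?_).trans (smul_le_smul_of_nonneg_right ?_ (hs _))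
    · rw [sub_apply, hv, apply_eq_zero_of_le (cut_nonneg _ _) (cut_le_cut hk) hv, sub_zero]
    · have : 2 * δ ^ k = 2 / δ * δ ^ (k + 1) := by field_simp; ring
      rw [this]
      have := norm_nonneg y
      have := pow_nonneg h0.le (k + 1)
      nlinarith
  have hzero : cut y (2 * δ ^ 0) ≤ ((‖y‖ + 2 / δ) * δ ^ 0) • supp (cut y (2 * δ ^ 0)) := by
    refine (le_smul_supp (m := ‖y‖) (cut_nonneg _ _) ?_ fun v hv => hv).trans
      (smul_le_smul_of_nonneg_right ?_ (hs _))
    · refine (cut_le_self hy (by positivity)).trans ?_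
      rw [← Algebra.algebraMap_eq_smul_one]
      exact hys.le_algebraMap_norm_self
    · have : 0 < 2 / δ := by positivity
      simp only [pow_zero, mul_one]
      linarith
  induction K with
  | zero => simpa using hzero
  | succ K ih =>
    rw [Finset.sum_range_succ]
    have := add_le_add ih (hstep K)
    rwa [add_sub_cancel] at this

end Cut

/-! ### Comparison of spectral projections; summability of powers. -/

section Comparison

variable {H : Type*} [NormedAddCommGroup H] [InnerProductSpace ℂ H] [CompleteSpace H]
variable {X : Type*} [MeasurableSpace X] {N Z : VonNeumannAlgebra H} {ν : Measure X}

namespace ZTrace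

variable {e : LInftyIso Z ν} {φ : ZTrace N Z e}

/-- The right support of `x` has at most the trace of a finite projection that dominates its left
support. -/
theorem val_supp_le {x p : H →L[ℂ] H} (hx : x ∈ N) (hp : IsStarProjection p) (hf : φ.IsFinite p)
    (h : ∀ v, p v = 0 → star x v = 0) : φ.val (supp x) ≤ φ.val p := by
  obtain ⟨u, hu, -, h1, h2, h3⟩ := exists_polar hx
  have h4 : supp (star x) ≤ p := supp_le_of_ker_le hp h
  have h5 := hf.of_le (supp_mem (star_mem hx)) h4
  rw [← h1, val_star_mul_self hu h3 (h2 ▸ h5), h2]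
  exact val_mono h5.mem hf.mem h4

/-- A projection `q` whose range meets the common kernel of `m` operators trivially has at most
`m` times the trace of a finite projection that dominates their left supports. -/
theorem val_le_of_ker_inf_eq_bot {p : H →L[ℂ] H} (hp : IsStarProjection p) (hf : φ.IsFinite p)
    {b : ℕ → H →L[ℂ] H} (hb : ∀ i, b i ∈ N) (hpb : ∀ i v, p v = 0 → star (b i) v = 0) (m : ℕ) :
    ∀ q : H →L[ℂ] H, q ∈ N → IsStarProjection q →
      (∀ v, q v = v → (∀ i < m, b i v = 0) → v = 0) → φ.val q ≤ φ.val (m • p) := by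
  induction m with
  | zero =>
    intro q hqN hq h
    have hq0 : q = 0 := by
      ext v
      refine h (q v) ?_ (by simp)
      exact congrArg (fun A : H →L[ℂ] H => A v) hq.isIdempotentElem.eq
    rw [hq0, zero_nsmul]
  | succ m ih =>
    intro q hqN hq h
    have hxN : b m * q ∈ N := mul_mem (hb m) hqN
    have hsN := supp_mem hxN
    have hsq : supp (b m * q) ≤ q := supp_le_of_ker_le hq fun v hv => by
      change b m (q v) = 0
      rw [hv, map_zero]
    have hqs : q * supp (b m * q) = supp (b m * q) :=
      (((isStarProjection_supp _).le_iff_mul_eq_right hq).1 hsq)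
    have h1 : φ.val (supp (b m * q)) ≤ φ.val p := val_supp_le hxN hp hf fun v hv => by
      rw [star_mul]
      change star q (star (b m) v) = 0
      rw [hpb m v hv, map_zero]
    -- The part of `q` seen by `b m` costs at most `φ(p)`. On the range of what remains `b m`
    -- vanishes, so only `m` operators are left to test.
    have hr : IsStarProjection (q - supp (b m * q)) :=
      ((isStarProjection_supp _).le_iff_sub hq).1 hsq
    have hrN : q - supp (b m * q) ∈ posCone N := ⟨sub_mem hqN hsN.1, hr.nonneg⟩
    have h2 : φ.val (q - supp (b m * q)) ≤ φ.val (m • p) := by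
      refine ih _ hrN.1 hr fun v hv hi => ?_
      have hqr : q * (q - supp (b m * q)) = q - supp (b m * q) := by
        rw [mul_sub, hq.isIdempotentElem.eq, hqs]
      have hsr : (b m * q) * (q - supp (b m * q)) = 0 := by
        rw [mul_sub, mul_supp, mul_assoc, hq.isIdempotentElem.eq, sub_self]
      have hqv : q v = v := by
        nth_rewrite 1 [← hv]
        rw [← mul_apply_eq_comp, hqr, hv]
      refine h v hqv fun i hi' => ?_
      rcases Nat.lt_succ_iff_lt_or_eq.1 hi' with hlt | rfl
      · exact hi i hlt
      · have h3 := congrArg (fun A : H →L[ℂ] H => A v) hsr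
        change b i (q ((q - supp (b i * q)) v)) = 0 at h3
        rwa [hv, hqv] at h3
    rw [succ_nsmul, val_add (nsmul_mem hf.mem m) hf.mem, ← sub_add_cancel q (supp (b m * q)),
      val_add hrN hsN]
    exact aeeqFun_add_le_add h2 h1

/-- Where all `supp (cut |R| t) * R ^ i` with `i < n` vanish, each application of `R` contracts by
`t`, giving `‖R ^ n v‖ ≤ t ^ n ‖v‖`. The factor 2 on the left contradicts this unless `v = 0`. -/
theorem val_supp_cut_abs_pow_le {R : H →L[ℂ] H} (hR : R ∈ N) (n : ℕ) {t : ℝ} (ht : 0 < t)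
    (hf : φ.IsFinite (supp (cut (CFC.abs R) t))) :
    φ.val (supp (cut (CFC.abs (R ^ n)) (2 * t ^ n))) ≤ φ.val (n • supp (cut (CFC.abs R) t)) := by
  have hpw : R ^ n ∈ N := pow_mem hR n
  refine val_le_of_ker_inf_eq_bot (b := fun i => supp (cut (CFC.abs R) t) * R ^ i)
    (isStarProjection_supp _) hf (fun i => mul_mem hf.mem.1 (pow_mem hR i)) (fun i v hv => ?_) n _
    (supp_mem (cut_mem (abs_mem hpw) _).1).1 (isStarProjection_supp _) fun v hv hi => ?_
  · rw [star_mul, star_supp]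
    change star (R ^ i) (supp (cut (CFC.abs R) t) v) = 0
    rw [hv, map_zero]
  · have h1 : ∀ i ≤ n, ‖(R ^ i) v‖ ≤ t ^ i * ‖v‖ := by
      intro i
      induction i with
      | zero => simp
      | succ i ih =>
        intro hin
        have h2 : cut (CFC.abs R) t ((R ^ i) v) = 0 := apply_eq_zero_of_supp (hi i hin)
        have h4 := norm_apply_le_of_cut_eq_zero (CFC.abs_nonneg R) ht.le h2
        rw [norm_abs_apply] at h4
        rw [pow_succ']
        refine h4.trans ((mul_le_mul_of_nonneg_left (ih (Nat.le_of_succ_le hin)) ht.le).trans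
          (le_of_eq (by ring)))
    have h2 := le_norm_apply_of_supp_cut (CFC.abs_nonneg (R ^ n)) (by positivity) hv
    rw [norm_abs_apply] at h2
    have h3 := h1 n le_rfl
    have h4 : 0 < t ^ n := pow_pos ht n
    refine norm_eq_zero.1 (le_antisymm ?_ (norm_nonneg v))
    nlinarith

/-- Hölder's inequality, qualitatively: `R ^ n` has finite trace if `R` is `n`-summable. -/
theorem isFinite_abs_pow (hφ : φ.Normal) {R : H →L[ℂ] H} (hR : R ∈ N) {n : ℕ} (hn : 0 < n)
    (h : φ.IsSummable n R) : φ.IsFinite (CFC.abs (R ^ n)) := by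
  set a := CFC.abs R with ha
  set y := CFC.abs (R ^ n) with hy
  have haN : a ∈ N := abs_mem hR
  have hyN : y ∈ N := abs_mem (pow_mem hR n)
  have ha0 : 0 ≤ a := CFC.abs_nonneg R
  -- Below, `δ = 2 ^ (-n)`, so that level `t = 2 ^ (-k)` of `a` corresponds to level `2 t ^ n = 2 δ
  -- ^ k` of `y`.
  have hy0 : 0 ≤ y := CFC.abs_nonneg _
  have hf : φ.IsFinite (a ^ n) := h
  set δ : ℝ := (2 : ℝ)⁻¹ ^ n with hδ
  have hδ0 : 0 < δ := by positivity
  have hδ1 : δ < 1 := pow_lt_one₀ (by norm_num) (by norm_num) hn.ne'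
  have hδk : ∀ k, δ ^ k = ((2 : ℝ)⁻¹ ^ k) ^ n := fun k => by rw [hδ, ← pow_mul, ← pow_mul, mul_comm]
  have hlow := sum_smul_supp_cut_le ha0 n
  have hep : ∀ k, supp (cut a ((2 : ℝ)⁻¹ ^ k)) ∈ posCone N := fun k => supp_mem (cut_mem haN _).1
  have hfp : ∀ k, supp (cut y (2 * δ ^ k)) ∈ posCone N := fun k => supp_mem (cut_mem hyN _).1
  have hc : ∀ k, 0 < δ ^ k * (1 - δ) := fun k => mul_pos (pow_pos hδ0 k) (by linarith)
  have hef : ∀ k, φ.IsFinite (supp (cut a ((2 : ℝ)⁻¹ ^ k))) := by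
    intro k
    have h1 := (Finset.single_le_sum (f := fun k => (δ ^ k * (1 - δ)) • supp (cut a ((2 : ℝ)⁻¹ ^ k)))
      (fun i _ => smul_nonneg (hc i).le (hep i).2) (Finset.self_mem_range_succ k)).trans (hlow (k + 1))
    have h2 := (hf.of_le (real_smul_mem_posCone (hc k).le (hep k)) h1).smul (inv_nonneg.2 (hc k).le)
    rwa [smul_smul, inv_mul_cancel₀ (hc k).ne', one_smul] at h2
  have hC : 0 ≤ ‖y‖ + 2 / δ := by positivity
  have hCn : 0 ≤ (‖y‖ + 2 / δ) * n / (1 - δ) := div_nonneg (by positivity) (by linarith)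
  -- The bound must not depend on `K`. The factor `n` comes from the comparison of projections, and
  -- `1 / (1 - δ)` undoes the coefficient in the lower bound for `a ^ n`.
  have hbound : ∀ K, φ.val (cut y (2 * δ ^ K)) ≤
      φ.val (((‖y‖ + 2 / δ) * n / (1 - δ)) • a ^ n) := by
    intro K
    have hm1 : ∀ k ∈ Finset.range (K + 1), ((‖y‖ + 2 / δ) * δ ^ k) • supp (cut y (2 * δ ^ k)) ∈
        posCone N := fun k _ => real_smul_mem_posCone (by positivity) (hfp k)
    have hm2 : ∀ k ∈ Finset.range (K + 1),
        ((‖y‖ + 2 / δ) * δ ^ k) • (n • supp (cut a ((2 : ℝ)⁻¹ ^ k))) ∈ posCone N := fun k _ =>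
      real_smul_mem_posCone (by positivity) (nsmul_mem (hep k) n)
    refine (val_mono (cut_mem hyN _) (sum_mem hm1)
      (cut_le_sum_smul_supp_cut hy0 hδ0 hδ1.le K)).trans ?_
    refine (val_sum_mono _ hm1 hm2 fun k _ => ?_).trans ?_
    · refine val_smul_mono (hfp k) (nsmul_mem (hep k) n) (by positivity) ?_
      rw [hδk]
      exact val_supp_cut_abs_pow_le hR n (by positivity) (hef k)
    · refine val_mono (sum_mem hm2) (hf.smul hCn).mem ?_
      refine le_trans (le_of_eq ?_) (smul_le_smul_of_nonneg_left (hlow (K + 1)) hCn)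
      rw [Finset.smul_sum]
      refine Finset.sum_congr rfl fun k _ => ?_
      rw [← Nat.cast_smul_eq_nsmul ℝ, smul_smul, smul_smul]
      congr 1
      have : 1 - δ ≠ 0 := by linarith
      rw [← hδ]
      field_simp
  let D : ℕ → posCone N := fun K => ⟨cut y (2 * δ ^ K), cut_mem hyN _⟩
  have hmono : ∀ {i j : ℕ}, i ≤ j → D i ≤ D j := fun {i j} hij =>
    cut_le_cut (a := y) (mul_le_mul_of_nonneg_left (pow_le_pow_of_le_one hδ0.le hδ1.le hij) zero_le_two)
  -- The truncations increase to `y` because `y - 2 δ ^ K ≤ cut y (2 * δ ^ K) ≤ y`.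
  have hlub : IsLUB (Set.range D) ⟨y, hyN, hy0⟩ := by
    constructor
    · rintro _ ⟨K, rfl⟩
      exact cut_le_self hy0 (by positivity)
    · intro z hz
      have h1 : ∀ K, y - (2 * δ ^ K) • (1 : H →L[ℂ] H) ≤ z := fun K =>
        (le_cut_add (.of_nonneg hy0) _).trans (hz ⟨K, rfl⟩)
      have h2 : Filter.Tendsto (fun K : ℕ => y - (2 * δ ^ K) • (1 : H →L[ℂ] H)) Filter.atTop
          (nhds (y - (2 * 0 : ℝ) • (1 : H →L[ℂ] H))) :=
        tendsto_const_nhds.sub (((tendsto_pow_atTop_nhds_zero_of_lt_one hδ0.le hδ1).const_mul 2).smul_const _)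
      rw [mul_zero, zero_smul, sub_zero] at h2
      change y ≤ (z : H →L[ℂ] H)
      exact le_of_tendsto' h2 h1
  have hsup := hφ (Set.range D) _ (Set.range_nonempty D)
    (directedOn_range.2 (fun i j => ⟨max i j, hmono (le_max_left i j), hmono (le_max_right i j)⟩)) hlub
  refine (hf.smul hCn).of_val_le ⟨hyN, hy0⟩ ?_
  rw [val_of_mem (x := y) ⟨hyN, hy0⟩]
  refine hsup.2 ?_
  rintro _ ⟨_, ⟨K, rfl⟩, rfl⟩
  rw [← val_of_mem]
  exact hbound K

theorem pow_mem_ideal (hφ : φ.Normal) {R : H →L[ℂ] H} (hR : R ∈ N) {n : ℕ} (hn : 0 < n)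
    (h : φ.IsSummable n R) : R ^ n ∈ φ.ideal := by
  obtain ⟨u, hu, h1, -⟩ := exists_polar (pow_mem hR n)
  rw [← h1]
  exact mul_mem_ideal_left (isFinite_abs_pow hφ hR hn h).mem_ideal hu

end ZTrace

end Comparison

/-! ### An explicit approximate inverse of `T`. -/

section Operators

variable {H : Type*} [NormedAddCommGroup H] [InnerProductSpace ℂ H] [CompleteSpace H]

theorem le_of_forall_re_inner_le {A B : H →L[ℂ] H} (hA : IsSelfAdjoint A) (hB : IsSelfAdjoint B)
    (h : ∀ v, RCLike.re (inner ℂ (A v) v) ≤ RCLike.re (inner ℂ (B v) v)) : A ≤ B := by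
  rw [ContinuousLinearMap.le_def, ContinuousLinearMap.isPositive_def']
  refine ⟨hB.sub hA, fun v => ?_⟩
  rw [ContinuousLinearMap.reApplyInnerSelf_apply, sub_apply, inner_sub_left, map_sub]
  exact sub_nonneg.2 (h v)

/-- A positive operator that fixes the range of a projection dominates the projection. -/
theorem le_of_mul_eq_self {p g : H →L[ℂ] H} (hp : IsStarProjection p) (hg : 0 ≤ g)
    (h : g * p = p) : p ≤ g := by
  have hps := hp.isSelfAdjoint.star_eq
  have h2 : p * g = p := by
    have := congrArg star h
    rwa [star_mul, hps, (IsSelfAdjoint.of_nonneg hg).star_eq] at this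
  have h4 : g - p = (1 - p) * g * star (1 - p) := by
    rw [star_sub, star_one, hps]
    simp only [sub_mul, one_mul, mul_sub, mul_one, h2, h, hp.isIdempotentElem.eq]
    abel
  rw [← sub_nonneg, h4]
  exact star_right_conjugate_nonneg hg _

/-- The operator `(1 - T* T / r)₊`, which is close to the projection onto `ker T`. -/
def nearKer (T : H →L[ℂ] H) (r : ℝ) : H →L[ℂ] H :=
  cfc (fun s : ℝ => max (1 - s / r) 0) (star T * T)

/-- The operator `max(T* T, r)⁻¹ T*`, an approximate inverse of `T`. -/
def nearInv (T : H →L[ℂ] H) (r : ℝ) : H →L[ℂ] H :=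
  cfc (fun s : ℝ => (max s r)⁻¹) (star T * T) * star T

theorem nearKer_mem {N : VonNeumannAlgebra H} {T : H →L[ℂ] H} (hT : T ∈ N) (r : ℝ) :
    nearKer T r ∈ posCone N :=
  cfc_mem_posCone (mul_mem (star_mem hT) hT) fun _ _ => le_max_right _ _

theorem nearInv_mem {N : VonNeumannAlgebra H} {T : H →L[ℂ] H} (hT : T ∈ N) (r : ℝ) :
    nearInv T r ∈ N :=
  mul_mem (cfc_mem (mul_mem (star_mem hT) hT) _) (star_mem hT)

theorem nearInv_mul (T : H →L[ℂ] H) {r : ℝ} (hr : 0 < r) : nearInv T r * T = 1 - nearKer T r := by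
  have hc : ContinuousOn (fun s : ℝ => (max s r)⁻¹) (spectrum ℝ (star T * T)) :=
    ContinuousOn.inv₀ (by fun_prop) fun s _ => (lt_max_of_lt_right hr).ne'
  rw [nearInv, nearKer, mul_assoc]
  conv_lhs => enter [2]; rw [← cfc_id' ℝ (star T * T)]
  rw [← cfc_mul (fun s : ℝ => (max s r)⁻¹) (fun s => s) _ hc, ← cfc_const_one ℝ (star T * T),
    ← cfc_sub ..]
  refine cfc_congr fun s hs => ?_
  have hs0 : 0 ≤ s := spectrum_nonneg_of_nonneg (star_mul_self_nonneg T) hs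
  rcases le_total s r with h | h
  · have h2 : s / r ≤ 1 := (div_le_one hr).2 h
    simp only [max_eq_right h, max_eq_left (sub_nonneg.2 h2)]
    field_simp
    ring
  · have h2 : 1 ≤ s / r := (one_le_div hr).2 h
    have h3 : s ≠ 0 := (hr.trans_le h).ne'
    simp only [max_eq_left h, max_eq_right (sub_nonpos.2 h2)]
    field_simp
    ring

theorem nearKer_mul_kerProj (T : H →L[ℂ] H) {r : ℝ} (hr : 0 < r) :
    nearKer T r * kerProj T = kerProj T := by
  have h : nearKer T r = 1 - nearInv T r * T := by rw [nearInv_mul T hr, sub_sub_cancel]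
  rw [h, sub_mul, mul_assoc, mul_kerProj, mul_zero, one_mul, sub_zero]

/-- In terms of the polar decomposition, `1 - T S` is positive for the approximate inverse `S`. -/
theorem one_sub_mul_nearInv {T u : H →L[ℂ] H} {r : ℝ} (hr : 0 < r) (hu : u * CFC.abs T = T)
    (hu' : u * star u = supp (star T)) :
    1 - T * nearInv T r = kerProj (star T) + u * nearKer T r * star u := by
  set A := CFC.abs T
  have hAsa : star A = A := (IsSelfAdjoint.of_nonneg (CFC.abs_nonneg T)).star_eq
  have hAA : A * A = star T * T := CFC.abs_mul_abs T
  have hT : star T = A * star u := by rw [← hu, star_mul, hAsa]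
  set G := cfc (fun s : ℝ => (max s r)⁻¹) (star T * T)
  have hcomm : Commute G A := by
    have : Commute (star T * T) A := by rw [← hAA]; exact (Commute.refl A).mul_left (Commute.refl A)
    exact this.cfc_real _
  have h1 : A * G * A = 1 - nearKer T r := by
    rw [← hcomm.eq, mul_assoc, hAA, ← nearInv_mul T hr, nearInv, mul_assoc]
  have h2 : T * nearInv T r = u * (A * G * A) * star u := by
    have h3 : nearInv T r = G * (A * star u) := by rw [← hT]; rfl
    rw [h3, ← mul_assoc, ← mul_assoc]
    nth_rewrite 1 [← hu]
    simp only [mul_assoc]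
  rw [h2, h1, mul_sub, sub_mul, mul_one, hu', supp]
  abel

/-- The range of `1 - A` contains the spectral subspace of `A` for the values at most `1 / 2`. -/
theorem ker_cut_le_range {A : H →L[ℂ] H} (hA : 0 ≤ A) :
    (cut A 2⁻¹).ker ≤ (1 - A).range := by
  have has : IsSelfAdjoint A := .of_nonneg hA
  have hc : ContinuousOn (fun s : ℝ => (max (1 - s) 2⁻¹)⁻¹) (spectrum ℝ A) :=
    ContinuousOn.inv₀ (by fun_prop) fun s _ => (lt_max_of_lt_right (by norm_num)).ne'
  -- A truncated inverse of `1 - s`: the product is 1 for `s ≤ 1/2` and `2 - 2 s = 1 - 2 (s - 1/2)`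
  -- beyond.
  have h1 : (1 - A) * cfc (fun s : ℝ => (max (1 - s) 2⁻¹)⁻¹) A = 1 - (2 : ℝ) • cut A 2⁻¹ := by
    have h2 : 1 - A = cfc (fun s : ℝ => 1 - s) A := by
      rw [cfc_sub .., cfc_id' .., cfc_const_one ..]
    rw [h2, ← cfc_mul (fun s : ℝ => 1 - s) (fun s => (max (1 - s) 2⁻¹)⁻¹) A (by fun_prop) hc, cut,
      ← cfc_const_mul .., ← cfc_const_one ℝ A, ← cfc_sub ..]
    refine cfc_congr fun s _ => ?_
    rcases le_total s 2⁻¹ with h | h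
    · have h3 : (2 : ℝ)⁻¹ ≤ 1 - s := by norm_num at h ⊢; linarith
      simp only [max_eq_left h3, max_eq_right (sub_nonpos.2 h)]
      rw [mul_inv_cancel₀ (by linarith [show (0 : ℝ) < 2⁻¹ by norm_num])]
      ring
    · have h3 : 1 - s ≤ (2 : ℝ)⁻¹ := by norm_num at h ⊢; linarith
      simp only [max_eq_right h3, max_eq_left (sub_nonneg.2 h)]
      ring
  intro v hv
  have hv' : cut A 2⁻¹ v = 0 := hv
  refine ⟨cfc (fun s : ℝ => (max (1 - s) 2⁻¹)⁻¹) A v, ?_⟩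
  have h4 := congrArg (fun B : H →L[ℂ] H => B v) h1
  have h5 : ((1 : H →L[ℂ] H) - (2 : ℝ) • cut A 2⁻¹) v = v := by
    change v - (2 : ℝ) • cut A 2⁻¹ v = v
    rw [hv', smul_zero, sub_zero]
  exact h4.trans h5

end Operators

/-! ### The index formula for remainders in the ideal. -/

section Index

variable {H : Type*} [NormedAddCommGroup H] [InnerProductSpace ℂ H] [CompleteSpace H]
variable {X : Type*} [MeasurableSpace X] {N Z : VonNeumannAlgebra H} {ν : Measure X}

namespace ZTrace

variable {e : LInftyIso Z ν} {φ : ZTrace N Z e}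

/-- Let `B` be the square root of `nearKer T r`. Since `T* T ≤ r` on the range of `B`, `‖S T B v‖ ≤
‖B v‖ / 2`, hence `‖B v‖ ≤ 2 ‖(1 - S T) B v‖`. Thus `B²` is dominated by `4 C* C` with `C = (1 - S
T) B` in the ideal. -/
theorem isFinite_nearKer {S T : H →L[ℂ] H} (hT : T ∈ N)
    (h : 1 - S * T ∈ φ.ideal) {r : ℝ} (hr : 0 < r) (hSr : ‖S‖ ^ 2 * r ≤ 4⁻¹) :
    φ.IsFinite (nearKer T r) := by
  set t := star T * T with ht
  have ht0 : 0 ≤ t := star_mul_self_nonneg T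
  have hts : IsSelfAdjoint t := .of_nonneg ht0
  set B := cfc (fun s : ℝ => √(max (1 - s / r) 0)) t with hB
  have hB0 : 0 ≤ B := cfc_nonneg fun _ _ => Real.sqrt_nonneg _
  have hBs : star B = B := (IsSelfAdjoint.of_nonneg hB0).star_eq
  have hBN : B ∈ N := cfc_mem (mul_mem (star_mem hT) hT) _
  have hBB : star B * B = nearKer T r := by
    rw [hBs, hB, nearKer, ← cfc_mul ..]
    exact cfc_congr fun s _ => Real.mul_self_sqrt (le_max_right _ _)
  have hTB : star (T * B) * (T * B) ≤ r • (star B * B) := by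
    have h1 : star (T * B) * (T * B) = B * t * B := by
      rw [star_mul, hBs, ht]
      simp only [mul_assoc]
    rw [h1, hBB, nearKer, ← cfc_const_mul ..]
    conv_lhs => enter [1, 2]; rw [← cfc_id' ℝ t]
    rw [hB, ← cfc_mul .., ← cfc_mul ..]
    refine cfc_mono (fun s hs => ?_) (by fun_prop) (by fun_prop)
    have hs0 : 0 ≤ s := spectrum_nonneg_of_nonneg ht0 hs
    have h3 : √(max (1 - s / r) 0) * s * √(max (1 - s / r) 0) = s * max (1 - s / r) 0 := by
      rw [mul_right_comm, Real.mul_self_sqrt (le_max_right _ _), mul_comm]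
    rw [h3]
    rcases le_total s r with h4 | h4
    · exact mul_le_mul_of_nonneg_right h4 (le_max_right _ _)
    · rw [max_eq_right (sub_nonpos.2 ((one_le_div hr).2 h4)), mul_zero, mul_zero]
  have hC : (1 - S * T) * B ∈ φ.ideal := mul_mem_ideal_right h hBN
  have hCC : star ((1 - S * T) * B) * ((1 - S * T) * B) ∈ φ.ideal :=
    mul_mem_ideal_left hC (star_mem (mem_of_mem_ideal hC))
  have hfin := (isFinite_of_mem_ideal hCC (star_mul_self_nonneg _)).smul (show (0 : ℝ) ≤ 4 by norm_num)
  refine hfin.of_le (nearKer_mem hT r) ?_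
  rw [← hBB]
  refine le_of_forall_re_inner_le (.star_mul_self B) (.of_nonneg hfin.mem.2) fun v => ?_
  have h1 : ‖(T * B) v‖ ^ 2 ≤ r * ‖B v‖ ^ 2 := by
    have := re_inner_le_of_le hTB v
    rw [← norm_sq_eq_re_inner] at this
    refine this.trans (le_of_eq ?_)
    rw [norm_sq_eq_re_inner B]
    change RCLike.re (inner ℂ (r • ((star B * B) v)) v) = _
    rw [← Complex.coe_smul, inner_smul_left, Complex.conj_ofReal]
    exact Complex.re_ofReal_mul _ _
  have h2 : ‖S ((T * B) v)‖ ≤ 2⁻¹ * ‖B v‖ := by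
    refine (abs_le_of_sq_le_sq' ?_ (by positivity)).2
    calc ‖S ((T * B) v)‖ ^ 2 ≤ (‖S‖ * ‖(T * B) v‖) ^ 2 :=
          pow_le_pow_left₀ (norm_nonneg _) (S.le_opNorm _) 2
      _ = ‖S‖ ^ 2 * ‖(T * B) v‖ ^ 2 := mul_pow _ _ _
      _ ≤ ‖S‖ ^ 2 * (r * ‖B v‖ ^ 2) := mul_le_mul_of_nonneg_left h1 (sq_nonneg _)
      _ = ‖S‖ ^ 2 * r * ‖B v‖ ^ 2 := by ring
      _ ≤ 4⁻¹ * ‖B v‖ ^ 2 := mul_le_mul_of_nonneg_right hSr (sq_nonneg _)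
      _ = (2⁻¹ * ‖B v‖) ^ 2 := by ring
  have h3 : B v = ((1 - S * T) * B) v + S ((T * B) v) := by
    rw [sub_mul, one_mul, sub_apply, mul_assoc, mul_apply_eq_comp, mul_apply_eq_comp,
      sub_add_cancel]
  have h4 : ‖B v‖ ≤ 2 * ‖((1 - S * T) * B) v‖ := by
    have := norm_add_le (((1 - S * T) * B) v) (S ((T * B) v))
    rw [← h3] at this
    linarith
  rw [← norm_sq_eq_re_inner]
  change _ ≤ RCLike.re (inner ℂ ((4 : ℝ) • ((star ((1 - S * T) * B) * ((1 - S * T) * B)) v)) v)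
  rw [← Complex.coe_smul, inner_smul_left, Complex.conj_ofReal]
  refine le_trans ?_ (le_of_eq (Complex.re_ofReal_mul _ _).symm)
  have h5 := norm_sq_eq_re_inner ((1 - S * T) * B) v
  change ‖((1 - S * T) * B) v‖ ^ 2 = Complex.re _ at h5
  rw [← h5]
  nlinarith [norm_nonneg (B v)]

/-- A projection of finite trace whose complement projects into the range of `1 - A`. -/
theorem exists_finite_projection {A : H →L[ℂ] H} (hA : φ.IsFinite A) :
    ∃ E : H →L[ℂ] H, IsStarProjection E ∧ φ.IsFinite E ∧ (1 - E).range ≤ (1 - A).range := by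
  have has : IsSelfAdjoint A := .of_nonneg hA.mem.2
  refine ⟨supp (cut A 2⁻¹), isStarProjection_supp _, ?_, ?_⟩
  -- The spectral projection of `A` above `1/2` is at most `2 A`, hence finite.
  · have h1 : (2⁻¹ : ℝ) • supp (cut A 2⁻¹) ≤ A := by
      have h2 : (2⁻¹ : ℝ) • supp (cut A 2⁻¹) ≤ cfc (fun s : ℝ => min s 2⁻¹) A := by
        refine smul_supp_le (.of_nonneg (cut_nonneg A _)) (cfc_nonneg fun s hs =>
          le_min (spectrum_nonneg_of_nonneg hA.mem.2 hs) (by norm_num)) ?_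
        rw [cut, ← cfc_mul .., ← cfc_const_mul ..]
        refine cfc_congr fun s _ => ?_
        rcases le_total s 2⁻¹ with h | h
        · simp only [max_eq_right (sub_nonpos.2 h), mul_zero]
        · simp only [min_eq_right h]
      refine h2.trans ?_
      conv_rhs => rw [← cfc_id ℝ A]
      exact cfc_mono (fun s _ => min_le_left _ _) (by fun_prop) (by fun_prop)
    have hm := supp_mem (cut_mem hA.mem.1 2⁻¹).1
    have h3 := (hA.of_le (real_smul_mem_posCone (by norm_num) hm) h1).smul
      (show (0 : ℝ) ≤ 2 by norm_num)
    rwa [smul_smul, mul_inv_cancel₀ two_ne_zero, one_smul] at h3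
  · rw [supp, sub_sub_cancel, range_kerProj]
    exact ker_cut_le_range hA.mem.2

/-- The index formula for a parametrix with remainders in the ideal of definition. -/
theorem index_eq_of_mem_ideal {S T : H →L[ℂ] H} (hS : S ∈ N) (hT : T ∈ N)
    (h₁ : 1 - S * T ∈ φ.ideal) (h₂ : 1 - T * S ∈ φ.ideal) :
    φ.IsFredholm T ∧ φ.IsFinite (kerProj (star T)) ∧
      φ.index T = φ.tr (1 - S * T) - φ.tr (1 - T * S) := by
  -- Small enough for `‖S‖² r ≤ 1/4`; the added 1 covers `S = 0`.
  set r : ℝ := (4 * (‖S‖ ^ 2 + 1))⁻¹ with hr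
  have hr0 : 0 < r := by positivity
  have hSr : ‖S‖ ^ 2 * r ≤ 4⁻¹ := by
    rw [hr, mul_inv, mul_left_comm, ← div_eq_mul_inv (‖S‖ ^ 2)]
    have : ‖S‖ ^ 2 / (‖S‖ ^ 2 + 1) ≤ 1 := (div_le_one (by positivity)).2 (by linarith)
    linarith
  have hK := isFinite_nearKer hT h₁ hr0 hSr
  set K := nearKer T r
  set S' := nearInv T r
  have hS' : S' ∈ N := nearInv_mem hT r
  have hS'T : S' * T = 1 - K := nearInv_mul T hr0
  obtain ⟨u, hu, hu1, hu2, hu3, -⟩ := exists_polar hT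
  have hTS' : 1 - T * S' = kerProj (star T) + u * K * star u := one_sub_mul_nearInv hr0 hu1 hu3
  -- Both are inverses of `T` modulo the ideal, so expanding `S' T S` in two ways shows that they
  -- agree modulo the ideal.
  have hD : S' - S ∈ φ.ideal := by
    have : S' - S = S' * (1 - T * S) - K * S := by
      rw [mul_sub, mul_one, ← mul_assoc, hS'T, sub_mul, one_mul]
      abel
    rw [this]
    exact sub_mem (mul_mem_ideal_left h₂ hS') (mul_mem_ideal_right hK.mem_ideal hS)
  have hTD := mul_mem_ideal_left hD hT
  have hDT := mul_mem_ideal_right hD hT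
  have hL : 1 - T * S' = (1 - T * S) - T * (S' - S) := by rw [mul_sub]; abel
  have hK' : K = (1 - S * T) - (S' - S) * T := by rw [sub_mul, hS'T]; abel
  have huK : u * K * star u ∈ posCone N := conj_mem_posCone hK.mem hu
  have hkT := kerProj_mem (N := N) hT
  have hkT' := kerProj_mem (N := N) (star_mem hT)
  have hLf : φ.IsFinite (1 - T * S') := by
    refine isFinite_of_mem_ideal (hL ▸ sub_mem h₂ hTD) ?_
    rw [hTS']
    exact add_nonneg hkT'.2 huK.2
  have hN' : φ.IsFinite (kerProj (star T)) :=
    hLf.of_le hkT' (by rw [hTS']; exact le_add_of_nonneg_right huK.2)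
  have hKN : K * kerProj T = kerProj T := nearKer_mul_kerProj T hr0
  have hN : φ.IsFinite (kerProj T) :=
    hK.of_le hkT (le_of_mul_eq_self (isStarProjection_kerProj T) hK.mem.2 hKN)
  obtain ⟨E, hE, hEf, hEr⟩ := exists_finite_projection hLf
  refine ⟨⟨hN, E, hE, hEf, hEr.trans ?_⟩, hN', ?_⟩
  · rw [sub_sub_cancel]
    rintro _ ⟨v, rfl⟩
    exact ⟨S' v, rfl⟩
  · have hKu : K * star u ∈ φ.ideal := mul_mem_ideal_right hK.mem_ideal (star_mem hu)
    -- Moving `u` around leaves `K u* u = K (1 - N_T) = K - N_T`, as `K` fixes the range of `N_T`.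
    have h3 : φ.tr (u * K * star u) = φ.tr K - φ.tr (kerProj T) := by
      rw [mul_assoc, tr_mul_comm hKu hu, mul_assoc, hu2, supp, mul_sub, mul_one, hKN,
        tr_sub hK.mem_ideal hN.mem_ideal]
    have h4 : φ.tr (1 - T * S') = φ.tr (kerProj (star T)) + (φ.tr K - φ.tr (kerProj T)) := by
      rw [hTS', tr_add hN'.mem_ideal (by rw [mul_assoc]; exact mul_mem_ideal_left hKu hu), h3]
    have h5 : φ.tr (1 - T * S') = φ.tr (1 - T * S) - φ.tr (T * (S' - S)) := by
      rw [hL, tr_sub h₂ hTD]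
    have h6 : φ.tr K = φ.tr (1 - S * T) - φ.tr ((S' - S) * T) := by rw [← tr_sub h₁ hDT, ← hK']
    have h7 := tr_mul_comm hD hT
    rw [index]
    rw [h5, h6, h7] at h4
    generalize φ.tr (kerProj T) = a at *
    generalize φ.tr (kerProj (star T)) = b at *
    generalize φ.tr (1 - S * T) = c at *
    generalize φ.tr (1 - T * S) = d at *
    have h8 : d = b + (c - a) := by
      have := congrArg (· + φ.tr ((S' - S) * T)) h4
      simp only [sub_add_cancel] at this
      rw [this]
      abel
    rw [h8]
    abel

end ZTrace

end Index

end

end CentreTrace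

theorem theoremA3 {H : Type*} [NormedAddCommGroup H] [InnerProductSpace ℂ H] [CompleteSpace H]
    {X : Type*} [MeasurableSpace X] (ν : Measure X)
    (N Z : VonNeumannAlgebra H) (hZN : Z ≤ N) (hZc : Z ≤ N.commutant)
    (e : CentreTrace.LInftyIso Z ν) (φ : CentreTrace.ZTrace N Z e)
    (hfaithful : φ.Faithful) (hnormal : φ.Normal) (hsemifinite : φ.Semifinite)
    (S T : H →L[ℂ] H) (hS : S ∈ N) (hT : T ∈ N) (n : ℕ) (hn : 0 < n)
    (hR₁ : φ.IsSummable n (1 - S * T)) (hR₂ : φ.IsSummable n (1 - T * S)) :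
    φ.IsFredholm T ∧ φ.IsFinite (CentreTrace.kerProj (star T)) ∧
      (1 - S * T) ^ n ∈ φ.ideal ∧ (1 - T * S) ^ n ∈ φ.ideal ∧
      φ.index T = φ.tr ((1 - S * T) ^ n) - φ.tr ((1 - T * S) ^ n) := by
  have h₁N : 1 - S * T ∈ N := sub_mem (one_mem N) (mul_mem hS hT)
  have h₂N : 1 - T * S ∈ N := sub_mem (one_mem N) (mul_mem hT hS)
  have h₁ := CentreTrace.ZTrace.pow_mem_ideal hnormal h₁N hn hR₁
  have h₂ := CentreTrace.ZTrace.pow_mem_ideal hnormal h₂N hn hR₂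
  -- Since `S R₂ = R₁ S`, the factor `S` can stand on either side of the geometric sum, so one
  -- operator `P` serves both remainders.
  have hconj : SemiconjBy S (1 - T * S) (1 - S * T) := by
    rw [SemiconjBy, mul_sub, sub_mul, mul_one, one_mul, mul_assoc]
  -- the parametrix with remainders `(1 - S T) ^ n` and `(1 - T S) ^ n`
  set P := S * ∑ i ∈ Finset.range n, (1 - T * S) ^ i with hP
  have hPN : P ∈ N := mul_mem hS (sum_mem fun i _ => pow_mem h₂N i)
  have hTP : 1 - T * P = (1 - T * S) ^ n := by
    have := mul_neg_geom_sum (1 - T * S) n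
    rw [sub_sub_cancel, mul_assoc] at this
    rw [hP, this, sub_sub_cancel]
  have hPT : 1 - P * T = (1 - S * T) ^ n := by
    have h := geom_sum_mul_neg (1 - S * T) n
    have hP' : P = (∑ i ∈ Finset.range n, (1 - S * T) ^ i) * S := by
      rw [hP, Finset.mul_sum, Finset.sum_mul]
      exact Finset.sum_congr rfl fun i _ => (hconj.pow_right i).eq
    rw [sub_sub_cancel, ← mul_assoc, ← hP'] at h
    rw [h, sub_sub_cancel]
  rw [← hTP] at h₂ ⊢
  rw [← hPT] at h₁ ⊢
  obtain ⟨h3, h4, h5⟩ := CentreTrace.ZTrace.index_eq_of_mem_ideal hPN hT h₁ h₂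
  exact ⟨h3, h4, h₁, h₂, h5⟩
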